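/- **Theorem 1 (Recovery guarantees for TDIHT with frames).** Let $1\le k\le p$ and let $\Omega\in\mathbb R^{p\times d}$ be a frame with constants $A,B$: $\Omega$ has full column rank, $A>0$, $\|\Omega\|_2\le B$ and $\|\Omega^\dagger\|_2\le 1/A$ (spectral norms). Let $y=Mx+e$ with $M\in\mathbb R^{m\times d}$. TDIHT with step size $1$ starts from $\hat w^0=0$, computes $w_g^t=\Omega\Omega^\dagger\hat w^{t-1}+\Omega M^*(y-M\Omega^\dagger\hat w^{t-1})$, obtains $\hat w^t$ from $w_g^t$ by keeping $k$ entries of largest magnitude (ties broken arbitrarily) and setting the others to zero, and returns $\hat x^t=\Omega^\dagger\hat w^t$. For $x\in\mathbb R^d$ let $T$ be a set of positions of $k$ entries of $\Omega x$ of largest magnitude, and put $$\mathcal E(x)=\frac{1+A}{A^2}\|\Omega_{T^C}x\|_2+\frac{1+A}{A^2\sqrt k}\|\Omega_{T^C}x\|_1 ,$$ which is $0$ when $\|\Omega x\|_0\le k$. There is an absolute constant $C>0$ such that the following holds. Say that $M$ *has the recovery guarantees* if * (adversarial noise) for all $x\in\mathbb R^d$, $e\in\mathbb R^m$, $\eta\ge0$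 and all $t$ with $2^{-t}\|\Omega_Tx\|_2\le B\|e\|_2+\eta$, $$\|x-\hat x^t\|_2\le C\Big(\frac{\eta}{A}+\frac BA\|e\|_2+\mathcal E(x)\Big);$$ * (Gaussian noise, $p\ge2$, ties broken measurably) for all $x\in\mathbb R^d$, $\sigma\ge0$, $\eta\ge0$, if the entries of $e$ are i.i.d. $N(0,\sigma^2)$ and TDIHT is stopped after $\tau$ iterations, where $\tau$ is any measurable function of $e$ such that almost surely $2^{-\tau}\|\Omega_Tx\|_2\le B\sqrt{k\log p}\,\sigma+\eta$, then $\|x-\hat x^\tau\|_2^2$ is integrable and $$\mathbb E\|x-\hat x^\tau\|_2^2\le C\Big(\frac{\eta^2}{A^2}+\frac{B^2}{A^2}\,k\log(p)\,\sigma^2+\mathcal E(x)^2\Big).$$ Then: 1. For every $m\ge C\,\frac BA\,k\log(ep/k)$ there is a matrix $M\in\mathbb R^{m\times d}$ (depending only on $\Omega,A,B,k,m$) that has the recovery guarantees. In particular $m=O(\frac BA k\log(ep/k))$ measurements are enough. 2. Every $M$ with $(1-\delta)\|v\|_2^2\le\|Mv\|_2^2\le(1+\delta)\|v\|_2^2$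 for $\delta=\frac{A}{4B}$ and for all $v=[\Omega^\dagger,\Omega^*]\alpha$ with $\alpha\in\mathbb R^{2p}$ $4k$-sparse (the D-RIP) has the recovery guarantees. 3. For every $K\ge 0$ there is $c>0$ depending only on $K$ such that for $m\ge c\,\frac{B^2}{A^2}\,k\log(ep/k)$, a random $M\in\mathbb R^{m\times d}$ with independent entries of mean $0$ and variance $1/m$, for which the variables $\sqrt m\,M_{ij}$ are sub-Gaussian with variance proxy $K$, has the recovery guarantees (with the same $C$) outside an event of probability at most $2\exp(-mA^2/(cB^2))$. -/

import Mathlib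

open MeasureTheory ProbabilityTheory
open scoped Matrix NNReal ENNReal Matrix.Norms.L2Operator

namespace TDIHT

/-- The Euclidean norm of a real vector. -/
noncomputable def l2 {ι : Type*} [Fintype ι] (v : ι → ℝ) : ℝ := ‖WithLp.toLp 2 v‖

/-- The `ℓ₁` norm of a real vector. -/
def l1 {ι : Type*} [Fintype ι] (v : ι → ℝ) : ℝ := ∑ i, |v i|

/-- `(w)_T`: keep the entries of `w` indexed by `T`, put the others to zero. -/
def restrict {ι : Type*} [DecidableEq ι] (T : Finset ι) (w : ι → ℝ) : ι → ℝ :=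
  fun i => if i ∈ T then w i else 0

/-- `w` has at most `k` nonzero entries. -/
def IsSparse {ι : Type*} [Fintype ι] (k : ℕ) (w : ι → ℝ) : Prop :=
  {i | w i ≠ 0}.ncard ≤ k

/-- `T` consists of the positions of `k` entries of `w` of largest magnitude. -/
def IsTopK {ι : Type*} (k : ℕ) (w : ι → ℝ) (T : Finset ι) : Prop :=
  T.card = k ∧ ∀ i ∈ T, ∀ j ∉ T, |w j| ≤ |w i|

/-- `supp` is a rule `w ↦ supp(w, k)`, with an arbitrary way to break ties. -/
def IsSuppRule {ι : Type*} (k : ℕ) (supp : (ι → ℝ) → Finset ι) : Prop :=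
  ∀ w, IsTopK k w (supp w)

/-- The Moore-Penrose pseudo-inverse of a matrix of full column rank. -/
noncomputable def pinv {p d : ℕ} (Ω : Matrix (Fin p) (Fin d) ℝ) : Matrix (Fin d) (Fin p) ℝ :=
  (Ωᵀ * Ω)⁻¹ * Ωᵀ

/-- For a matrix of full column rank, `pinv` is a left inverse, and it satisfies the
four Penrose equations. -/
theorem pinv_penrose {p d : ℕ} {Ω : Matrix (Fin p) (Fin d) ℝ}
    (h : Function.Injective Ω.mulVec) :
    pinv Ω * Ω = 1 ∧ Ω * pinv Ω * Ω = Ω ∧ pinv Ω * Ω * pinv Ω = pinv Ω ∧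
      (Ω * pinv Ω)ᵀ = Ω * pinv Ω ∧ (pinv Ω * Ω)ᵀ = pinv Ω * Ω := by
  have hinj : Function.Injective (Ωᵀ * Ω).mulVec := by
    intro u v huv
    have h0 : (Ωᵀ * Ω) *ᵥ (u - v) = 0 := by
      rw [Matrix.mulVec_sub]; exact sub_eq_zero.mpr huv
    have h1 : (Ω *ᵥ (u - v)) ⬝ᵥ (Ω *ᵥ (u - v)) = 0 := by
      have h3 : (u - v) ⬝ᵥ ((Ωᵀ * Ω) *ᵥ (u - v)) = 0 := by rw [h0]; simp
      rw [← Matrix.mulVec_mulVec, Matrix.dotProduct_mulVec, Matrix.vecMul_transpose] at h3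
      exact h3
    have h4 : Ω *ᵥ (u - v) = 0 := dotProduct_self_eq_zero.mp h1
    rw [Matrix.mulVec_sub] at h4
    exact h (sub_eq_zero.mp h4)
  have hunit : IsUnit (Ωᵀ * Ω) := Matrix.mulVec_injective_iff_isUnit.mp hinj
  have hdet : IsUnit (Ωᵀ * Ω).det := (Matrix.isUnit_iff_isUnit_det _).mp hunit
  have hl : pinv Ω * Ω = 1 := by
    rw [pinv, Matrix.mul_assoc, Matrix.nonsing_inv_mul _ hdet]
  refine ⟨hl, ?_, ?_, ?_, ?_⟩
  · rw [Matrix.mul_assoc, hl, Matrix.mul_one]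
  · rw [hl, Matrix.one_mul]
  · simp [pinv, Matrix.transpose_mul, Matrix.transpose_nonsing_inv, Matrix.mul_assoc]
  · rw [hl, Matrix.transpose_one]

/-- The rows of `Ω` form a frame with constants `A` and `B`: `‖Ω‖ ≤ B` and `‖Ω†‖ ≤ 1 / A` in
the spectral norm. -/
structure IsFrame {p d : ℕ} (Ω : Matrix (Fin p) (Fin d) ℝ) (A B : ℝ) : Prop where
  injective : Function.Injective Ω.mulVec
  pos : 0 < A
  norm_le : ‖Ω‖ ≤ B
  norm_pinv_le : ‖pinv Ω‖ ≤ 1 / A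

/-- `M` has the D-RIP of order `k` with the dictionary `D` and a constant at most `δ`. -/
def HasDRIP {m d : ℕ} {ι : Type*} [Fintype ι] (M : Matrix (Fin m) (Fin d) ℝ)
    (D : Matrix (Fin d) ι ℝ) (k : ℕ) (δ : ℝ) : Prop :=
  ∀ α : ι → ℝ, IsSparse k α →
    (1 - δ) * l2 (D *ᵥ α) ^ 2 ≤ l2 (M *ᵥ (D *ᵥ α)) ^ 2 ∧
      l2 (M *ᵥ (D *ᵥ α)) ^ 2 ≤ (1 + δ) * l2 (D *ᵥ α) ^ 2

section Algorithm

variable {m p d : ℕ} (M : Matrix (Fin m) (Fin d) ℝ) (Ω : Matrix (Fin p) (Fin d) ℝ)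
  (supp : (Fin p → ℝ) → Finset (Fin p)) (y : Fin m → ℝ)

/-- The gradient step of TDIHT (step size `1`, `D = Ω†`) from the transform-domain vector `w`. -/
noncomputable def gradStep (w : Fin p → ℝ) : Fin p → ℝ :=
  Ω *ᵥ (pinv Ω *ᵥ w) + Ω *ᵥ (Mᵀ *ᵥ (y - M *ᵥ (pinv Ω *ᵥ w)))

/-- The transform-domain estimates of TDIHT. -/
noncomputable def iter : ℕ → Fin p → ℝ
  | 0 => 0
  | t + 1 => restrict (supp (gradStep M Ω y (iter t))) (gradStep M Ω y (iter t))

/-- The output of TDIHT after `t` iterations. -/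
noncomputable def output (t : ℕ) : Fin d → ℝ := pinv Ω *ᵥ iter M Ω supp y t

end Algorithm

/-- The model mismatch term, a function of the vector `u = Ω_{Tᶜ} x`. -/
noncomputable def mismatch {p : ℕ} (A : ℝ) (k : ℕ) (u : Fin p → ℝ) : ℝ :=
  (1 + A) / A ^ 2 * l2 u + (1 + A) / (A ^ 2 * √k) * l1 u

/-- Stable recovery under adversarial noise: `η` is the precision to which the algorithm is run
(`η = 0` is allowed). The signal `x` is arbitrary; if `Ω x` is `k`-sparse, the mismatch is zero. -/
def StableRecovery {m p d : ℕ} (C : ℝ) (k : ℕ) (A B : ℝ) (Ω : Matrix (Fin p) (Fin d) ℝ)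
    (M : Matrix (Fin m) (Fin d) ℝ) : Prop :=
  ∀ supp : (Fin p → ℝ) → Finset (Fin p), IsSuppRule k supp →
  ∀ (x : Fin d → ℝ) (T : Finset (Fin p)), IsTopK k (Ω *ᵥ x) T →
  ∀ (e : Fin m → ℝ) (η : ℝ) (t : ℕ), 0 ≤ η →
    (1 / 2) ^ t * l2 (restrict T (Ω *ᵥ x)) ≤ B * l2 e + η →
    l2 (x - output M Ω supp (M *ᵥ x + e) t) ≤
      C * (η / A + B / A * l2 e + mismatch A k (restrict Tᶜ (Ω *ᵥ x)))

/-- The law of `m` i.i.d. Gaussian variables with mean zero and variance `σ ^ 2`. -/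
noncomputable def gaussianNoise (m : ℕ) (σ : ℝ≥0) : Measure (Fin m → ℝ) :=
  Measure.pi fun _ => gaussianReal 0 (σ ^ 2)

/-- Denoising of i.i.d. Gaussian noise; ties are broken in a measurable way, and the
number `τ` of iterations may depend on the noise. Here `η` has the same role as above. -/
def Denoising {m p d : ℕ} (C : ℝ) (k : ℕ) (A B : ℝ) (Ω : Matrix (Fin p) (Fin d) ℝ)
    (M : Matrix (Fin m) (Fin d) ℝ) : Prop :=
  ∀ supp : (Fin p → ℝ) → Finset (Fin p), IsSuppRule k supp →
    (∀ S, MeasurableSet {w | supp w = S}) →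
  ∀ (x : Fin d → ℝ) (T : Finset (Fin p)), IsTopK k (Ω *ᵥ x) T →
  ∀ (σ : ℝ≥0) (η : ℝ) (τ : (Fin m → ℝ) → ℕ), 0 ≤ η → Measurable τ →
    (∀ᵐ e ∂gaussianNoise m σ,
      (1 / 2) ^ τ e * l2 (restrict T (Ω *ᵥ x)) ≤ B * √(k * Real.log p) * σ + η) →
    Integrable (fun e => l2 (x - output M Ω supp (M *ᵥ x + e) (τ e)) ^ 2) (gaussianNoise m σ) ∧
    ∫ e, l2 (x - output M Ω supp (M *ᵥ x + e) (τ e)) ^ 2 ∂gaussianNoise m σ ≤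
      C * ((η / A) ^ 2 + B ^ 2 / A ^ 2 * (k * Real.log p) * σ ^ 2
        + mismatch A k (restrict Tᶜ (Ω *ᵥ x)) ^ 2)

/-- Both recovery guarantees. For `p = 1` the factor `log p` vanishes, so that the denoising
bound is claimed for `p ≥ 2` only. -/
def Guarantee {m p d : ℕ} (C : ℝ) (k : ℕ) (A B : ℝ) (Ω : Matrix (Fin p) (Fin d) ℝ)
    (M : Matrix (Fin m) (Fin d) ℝ) : Prop :=
  StableRecovery C k A B Ω M ∧ (2 ≤ p → Denoising C k A B Ω M)

/-- `M` is a random `m × d` matrix with independent entries of mean zero and variance `1 / m`,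
whose rescalings by `√m` are sub-Gaussian with variance proxy `K`. -/
structure IsSubgaussianMatrix {S : Type*} [MeasurableSpace S] (μ : Measure S) {m d : ℕ} (K : ℝ≥0)
    (M : S → Matrix (Fin m) (Fin d) ℝ) : Prop where
  aemeasurable : ∀ i j, AEMeasurable (fun s => M s i j) μ
  indep : iIndepFun (fun (ij : Fin m × Fin d) (s : S) => M s ij.1 ij.2) μ
  mean : ∀ i j, ∫ s, M s i j ∂μ = 0
  variance : ∀ i j, ∫ s, (M s i j) ^ 2 ∂μ = 1 / m
  subgaussian : ∀ i j, HasSubgaussianMGF (fun s => √m * M s i j) K μ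

end TDIHT

/-! Write `w = Ω x`, `r = w_{Tᶜ}` and `F h = Ω (I - Mᵀ M) Ω† h`. Since `Ω† w = x`, one gradient step
from `z` has error `g - w_T = F (z - w_T) - F r + r + Ω Mᵀ e`. Keeping the `k` largest entries of
`g` at most doubles the error seen on the union of two supports, a set of at most `2k` positions. So
it is enough that `F`, restricted to `2k` positions, shrinks `2k`-sparse vectors by `1/4`: the error
in the transform domain is then halved at each step, up to noise and mismatch. By duality this is a
statement about the inner products of `Ωᵀ u` and `Ω† h` for sparse `u` and `h`, which is
`RestrictedContraction`; both recovery guarantees follow from it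
(`RestrictedContraction.guarantee`). The tail `r` is not sparse, and cutting it into blocks of size
`k` bounds `F r` by `l2 r + l1 r / √k`.

The noise enters only through `Ω Mᵀ e` on `2k` positions. Adversarial noise costs `2 B ‖e‖`. For
Gaussian noise each coordinate is sub-Gaussian with parameter at most `2 B σ`, and the expected
maximal square over `p` coordinates is of order `B² σ² log p`. The estimate is uniform in the number
of iterations, so the stopping time may depend on the noise.

It remains to find matrices with the contraction. As `‖Ωᵀ u‖ ≤ B ‖u‖` and `‖Ω† h‖ ≤ ‖h‖ / A`, the
D-RIP with constant `A / (4B)` suffices. Sub-Gaussian matrices have it by a Bernstein inequality,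
nets in the spans of `4k` atoms and a union bound, at the price of `(B / A)²` in the number of rows.

To pay only `B / A`, cut the spectrum of `Ωᵀ Ω` at `A B`. Below the cut `Ωᵀ` has norm at most
`√(AB)`; above it `Ω†` has norm at most `1 / √(AB)`. On both parts the product of the two norms is
`√(B / A)` instead of `B / A`, so an isometry constant of order `√(A / B)` is enough. Two matrices,
one for each spectral subspace, are stacked (`exists_restrictedContraction`). -/

namespace TDIHT

/-! ### Euclidean norm and polarization -/

section EuclideanNorm

variable {ι κ : Type*} [Fintype ι] [Fintype κ]

theorem l2_nonneg (v : ι → ℝ) : 0 ≤ l2 v := norm_nonneg _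

theorem l2_sq (v : ι → ℝ) : l2 v ^ 2 = v ⬝ᵥ v := by
  rw [l2, EuclideanSpace.norm_sq_eq]; simp [dotProduct, sq]

theorem l2_sq_eq_sum (v : ι → ℝ) : l2 v ^ 2 = ∑ i, v i ^ 2 := by
  rw [l2_sq]; simp [dotProduct, sq]

@[simp] theorem l2_zero : l2 (0 : ι → ℝ) = 0 := by simp [l2]

theorem l2_add_le (u v : ι → ℝ) : l2 (u + v) ≤ l2 u + l2 v := by
  simpa [l2] using norm_add_le (WithLp.toLp 2 u) (WithLp.toLp 2 v)

theorem l2_sub_le (u v : ι → ℝ) : l2 (u - v) ≤ l2 u + l2 v := by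
  simpa [l2] using norm_sub_le (WithLp.toLp 2 u) (WithLp.toLp 2 v)

theorem l2_smul (a : ℝ) (v : ι → ℝ) : l2 (a • v) = |a| * l2 v := by
  simp [l2, norm_smul]

theorem l2_neg (v : ι → ℝ) : l2 (-v) = l2 v := by
  simp [l2]

theorem eq_zero_of_l2_eq_zero {v : ι → ℝ} (h : l2 v = 0) : v = 0 := by
  have : v ⬝ᵥ v = 0 := by rw [← l2_sq, h]; norm_num
  exact dotProduct_self_eq_zero.mp this

theorem abs_dotProduct_le (u v : ι → ℝ) : |u ⬝ᵥ v| ≤ l2 u * l2 v := by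
  have := abs_real_inner_le_norm (WithLp.toLp 2 u) (WithLp.toLp 2 v)
  simpa [l2, EuclideanSpace.inner_eq_star_dotProduct, dotProduct_comm] using this

theorem l2_mulVec_le [DecidableEq κ] (X : Matrix ι κ ℝ) (v : κ → ℝ) :
    l2 (X *ᵥ v) ≤ ‖X‖ * l2 v := by
  simpa [l2] using Matrix.l2_opNorm_mulVec X (WithLp.toLp 2 v)

theorem l2_transpose_mulVec_le [DecidableEq κ] (X : Matrix ι κ ℝ) (v : ι → ℝ) :
    l2 (Xᵀ *ᵥ v) ≤ ‖X‖ * l2 v := by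
  have h1 : l2 (Xᵀ *ᵥ v) ^ 2 ≤ (‖X‖ * l2 v) * l2 (Xᵀ *ᵥ v) := by
    rw [l2_sq, Matrix.dotProduct_mulVec, Matrix.vecMul_transpose]
    refine (le_abs_self _).trans ((abs_dotProduct_le _ _).trans ?_)
    have := mul_le_mul_of_nonneg_right (l2_mulVec_le X (Xᵀ *ᵥ v)) (l2_nonneg v)
    linarith
  by_contra! h
  have := l2_nonneg v
  have := norm_nonneg X
  have h0 : 0 < l2 (Xᵀ *ᵥ v) := lt_of_le_of_lt (by positivity) h
  nlinarith

theorem l2_le_of_sq_le_mul {v : ι → ℝ} {c : ℝ} (hc : 0 ≤ c) (h : l2 v ^ 2 ≤ c * l2 v) :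
    l2 v ≤ c := by
  by_contra! h'
  have h0 : 0 < l2 v := lt_of_le_of_lt hc h'
  nlinarith

/-- Polarization: a linear map that is nearly isometric on the plane spanned by `a` and `b`
nearly preserves their inner product. -/
theorem abs_dotProduct_sub_le (M : Matrix κ ι ℝ) {a b : ι → ℝ} {δ : ℝ}
    (h : ∀ r s : ℝ, |l2 (M *ᵥ (r • a + s • b)) ^ 2 - l2 (r • a + s • b) ^ 2|
      ≤ δ * l2 (r • a + s • b) ^ 2) :
    |a ⬝ᵥ b - (M *ᵥ a) ⬝ᵥ (M *ᵥ b)| ≤ δ * (l2 a * l2 b) := by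
  have e1 : ∀ r s : ℝ, l2 (r • a + s • b) ^ 2
      = r ^ 2 * l2 a ^ 2 + 2 * r * s * (a ⬝ᵥ b) + s ^ 2 * l2 b ^ 2 := by
    intro r s
    simp only [l2_sq, add_dotProduct, dotProduct_add, smul_dotProduct, dotProduct_smul,
      smul_eq_mul, dotProduct_comm b a]
    ring
  have e2 : ∀ r s : ℝ, l2 (M *ᵥ (r • a + s • b)) ^ 2
      = r ^ 2 * l2 (M *ᵥ a) ^ 2 + 2 * r * s * ((M *ᵥ a) ⬝ᵥ (M *ᵥ b))
        + s ^ 2 * l2 (M *ᵥ b) ^ 2 := by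
    intro r s
    simp only [l2_sq, Matrix.mulVec_add, Matrix.mulVec_smul, add_dotProduct, dotProduct_add,
      smul_dotProduct, dotProduct_smul, smul_eq_mul, dotProduct_comm (M *ᵥ b) (M *ᵥ a)]
    ring
  rcases eq_or_ne (l2 a) 0 with ha | ha
  · simp [eq_zero_of_l2_eq_zero ha]
  rcases eq_or_ne (l2 b) 0 with hb | hb
  · simp [eq_zero_of_l2_eq_zero hb]
  have ha' : 0 < l2 a := lt_of_le_of_ne (l2_nonneg a) (Ne.symm ha)
  have hb' : 0 < l2 b := lt_of_le_of_ne (l2_nonneg b) (Ne.symm hb)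
  -- These weights give both vectors the same length. In the difference of the two estimates the
  -- squares cancel, leaving `4 ‖a‖ ‖b‖` times the defect of the inner product, against `4 δ ‖a‖²
  -- ‖b‖²`.
  have hp := h (l2 b) (l2 a)
  have hm := h (l2 b) (-l2 a)
  rw [e1, e2, abs_le] at hp hm
  have hab : 0 < l2 a * l2 b := mul_pos ha' hb'
  rw [abs_le]
  constructor
  · refine le_of_mul_le_mul_left ?_ hab
    nlinarith [hp.1, hp.2, hm.1, hm.2]
  · refine le_of_mul_le_mul_left ?_ hab
    nlinarith [hp.1, hp.2, hm.1, hm.2]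

end EuclideanNorm

theorem IsSparse.mono {ι : Type*} [Fintype ι] {k l : ℕ} (h : k ≤ l) {w : ι → ℝ}
    (hw : IsSparse k w) : IsSparse l w :=
  le_trans hw h

/-! ### Hard thresholding and block decompositions -/

section Restriction

variable {ι : Type*} [DecidableEq ι]

theorem restrict_sub (T : Finset ι) (u v : ι → ℝ) :
    restrict T (u - v) = restrict T u - restrict T v := by
  ext i; by_cases h : i ∈ T <;> simp [restrict, h]

theorem restrict_add (T : Finset ι) (u v : ι → ℝ) :
    restrict T (u + v) = restrict T u + restrict T v := by
  ext i; by_cases h : i ∈ T <;> simp [restrict, h]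

variable [Fintype ι]

theorem restrict_add_restrict_compl (T : Finset ι) (w : ι → ℝ) :
    restrict T w + restrict Tᶜ w = w := by
  ext i; by_cases h : i ∈ T <;> simp [restrict, h]

theorem l2_restrict_sq (T : Finset ι) (w : ι → ℝ) : l2 (restrict T w) ^ 2 = ∑ i ∈ T, w i ^ 2 := by
  simp [l2_sq_eq_sum, restrict, ite_pow, Finset.sum_ite_mem]

theorem l2_restrict_le (T : Finset ι) (w : ι → ℝ) : l2 (restrict T w) ≤ l2 w := by
  refine (sq_le_sq₀ (l2_nonneg _) (l2_nonneg _)).mp ?_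
  rw [l2_restrict_sq, l2_sq_eq_sum]
  exact Finset.sum_le_univ_sum_of_nonneg fun i => sq_nonneg _

theorem restrict_dotProduct (T : Finset ι) (u v : ι → ℝ) :
    restrict T u ⬝ᵥ restrict T v = restrict T u ⬝ᵥ v := by
  refine Finset.sum_congr rfl fun i _ => ?_
  by_cases h : i ∈ T <;> simp [restrict, h]

theorem isSparse_of_support_subset {k : ℕ} {w : ι → ℝ} {T : Finset ι} (hT : T.card ≤ k)
    (h : ∀ i ∉ T, w i = 0) : IsSparse k w := by
  refine le_trans ?_ hT
  rw [← Set.ncard_coe_finset]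
  refine Set.ncard_le_ncard (fun i hi => ?_) (Finset.finite_toSet T)
  by_contra hiT
  exact hi (h i hiT)

theorem isSparse_restrict {k : ℕ} {T : Finset ι} (hT : T.card ≤ k) (w : ι → ℝ) :
    IsSparse k (restrict T w) :=
  isSparse_of_support_subset hT fun i hi => by simp [restrict, hi]

/-- Hard thresholding of `g` at least halves the accuracy, on the union of the supports. -/
theorem l2_restrict_topK_sub_le {k : ℕ} {g v : ι → ℝ} {T T' : Finset ι} (hT' : IsTopK k g T')
    (hT : T.card = k) (hv : ∀ i ∉ T, v i = 0) :
    l2 (restrict T' g - v) ≤ 2 * l2 (restrict (T ∪ T') (g - v)) := by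
  have hvS : restrict (T ∪ T') v = v := by
    ext i; by_cases h : i ∈ T ∪ T'
    · simp [restrict, h]
    · rw [Finset.mem_union, not_or] at h
      simp [restrict, h, hv i h.1]
  have hgS : restrict T' g - restrict (T ∪ T') g = - restrict (T \ T') g := by
    ext i; by_cases h : i ∈ T <;> by_cases h' : i ∈ T' <;> simp [restrict, h, h']
  -- What thresholding wrongly discards lies on `T \ T'`. The set `T' \ T` has the same size and
  -- carries entries of `g` at least as large, and there `v = 0`, so these entries are pure error.
  have key : l2 (restrict (T \ T') g) ≤ l2 (restrict (T ∪ T') (g - v)) := by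
    refine (sq_le_sq₀ (l2_nonneg _) (l2_nonneg _)).mp ?_
    rw [l2_restrict_sq, l2_restrict_sq]
    have hcard : (T \ T').card = (T' \ T).card := by
      have h1 := Finset.card_sdiff_add_card_inter T T'
      have h2 := Finset.card_sdiff_add_card_inter T' T
      rw [Finset.inter_comm] at h2
      have := hT'.1
      omega
    have h1 : ∑ i ∈ T \ T', g i ^ 2 ≤ ∑ i ∈ T' \ T, g i ^ 2 := by
      have e : ↥(T \ T') ≃ ↥(T' \ T) := Finset.equivOfCardEq hcard
      rw [← Finset.sum_coe_sort (T \ T'), ← Finset.sum_coe_sort (T' \ T),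
        ← Equiv.sum_comp e]
      refine Finset.sum_le_sum fun i _ => ?_
      have hi := Finset.mem_sdiff.mp i.2
      have hei := Finset.mem_sdiff.mp (e i).2
      exact sq_le_sq.mpr (hT'.2 _ hei.1 _ hi.2)
    refine h1.trans ?_
    have h2 : ∑ i ∈ T' \ T, g i ^ 2 = ∑ i ∈ T' \ T, (g - v) i ^ 2 :=
      Finset.sum_congr rfl fun i hi => by simp [hv i (Finset.mem_sdiff.mp hi).2]
    rw [h2]
    refine Finset.sum_le_sum_of_subset_of_nonneg ?_ fun i _ _ => sq_nonneg _
    exact Finset.sdiff_subset.trans Finset.subset_union_right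
  have e : restrict T' g - v
      = (restrict T' g - restrict (T ∪ T') g) + restrict (T ∪ T') (g - v) := by
    rw [restrict_sub, hvS]; abel
  rw [e, hgS]
  refine (l2_add_le _ _).trans ?_
  rw [l2_neg]
  linarith

/-- A subadditive function that is bounded by `c * l2` on `k`-sparse vectors is bounded by
`c * (l2 + l1 / √k)` on all vectors. -/
theorem le_l2_add_l1_of_isSparse {k : ℕ} (hk : 1 ≤ k) {supp : (ι → ℝ) → Finset ι}
    (hs : IsSuppRule k supp) {g : (ι → ℝ) → ℝ} (hadd : ∀ u v, g (u + v) ≤ g u + g v) {c : ℝ}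
    (hc : 0 ≤ c) (hg : ∀ u, IsSparse k u → g u ≤ c * l2 u) (u : ι → ℝ) :
    g u ≤ c * (l2 u + l1 u / √k) := by
  have hk0 : (0 : ℝ) < k := by exact_mod_cast hk
  have hsk : 0 < √(k : ℝ) := Real.sqrt_pos.mpr hk0
  have hskk : √(k : ℝ) * √k = k := Real.mul_self_sqrt hk0.le
  have hdiv : ∀ l : ℝ, √(k : ℝ) * (l / k) = l / √k := by
    intro l
    rw [eq_div_iff hsk.ne', show √(k : ℝ) * (l / k) * √k = (√k * √k) * (l / k) by ring, hskk]
    field_simp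
  -- splitting off the `k` largest entries
  have hsplit : ∀ u : ι → ℝ, ∀ i, |restrict (supp u)ᶜ u i| ≤ l1 (restrict (supp u) u) / k := by
    intro u i
    rw [le_div_iff₀ hk0]
    by_cases hi : i ∈ supp u
    · simp [restrict, hi, l1]; positivity
    · have h1 : l1 (restrict (supp u) u) = ∑ j ∈ supp u, |u j| := by
        simp [l1, restrict, apply_ite abs, Finset.sum_ite_mem]
      have h2 : ∑ j ∈ supp u, |u i| ≤ ∑ j ∈ supp u, |u j| :=
        Finset.sum_le_sum fun j hj => (hs u).2 j hj i hi
      rw [Finset.sum_const, (hs u).1, nsmul_eq_mul] at h2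
      rw [h1]; simp [restrict, hi]; linarith
  have hl1 : ∀ (T : Finset ι) (u : ι → ℝ), l1 (restrict T u) + l1 (restrict Tᶜ u) = l1 u := by
    intro T u
    rw [l1, l1, l1, ← Finset.sum_add_distrib]
    refine Finset.sum_congr rfl fun i _ => ?_
    by_cases h : i ∈ T <;> simp [restrict, h]
  -- Peeling off the `k` largest entries costs `√k * b`. Each remaining entry is at most the average
  -- of the peeled ones, so `l1 (peeled) / k` bounds the next block, and the costs of all later
  -- blocks add up to at most `l1 u / √k`. The support shrinks at every step unless the peeled block
  -- contains a zero, in which case nothing is left.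
  have hsup : ∀ (n : ℕ) (u : ι → ℝ) (b : ℝ), {i | u i ≠ 0}.ncard ≤ n → (∀ i, |u i| ≤ b) → 0 ≤ b →
      g u ≤ c * (√k * b + l1 u / √k) := by
    intro n
    induction n using Nat.strong_induction_on with
    | _ n ih =>
      intro u b hn hb hb0
      have hl2 : l2 (restrict (supp u) u) ≤ √k * b := by
        refine (sq_le_sq₀ (l2_nonneg _) (by positivity)).mp ?_
        rw [l2_restrict_sq, mul_pow, sq √(k : ℝ), hskk, ← (hs u).1, ← nsmul_eq_mul,
          ← Finset.sum_const]
        exact Finset.sum_le_sum fun i _ => sq_le_sq.mpr ((hb i).trans (le_abs_self b))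
      have hfirst : g (restrict (supp u) u) ≤ c * (√k * b) :=
        (hg _ (isSparse_restrict (hs u).1.le u)).trans (by gcongr)
      by_cases hz : ∃ i ∈ supp u, u i = 0
      · obtain ⟨i, hi, hi0⟩ := hz
        have : restrict (supp u) u = u := by
          ext j
          by_cases hj : j ∈ supp u
          · simp [restrict, hj]
          · have := (hs u).2 i hi j hj
            rw [hi0, abs_zero, abs_nonpos_iff] at this
            simp [restrict, this]
        rw [this] at hfirst
        refine hfirst.trans ?_
        have : 0 ≤ l1 u := Finset.sum_nonneg fun i _ => abs_nonneg _
        gcongr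
        have : 0 ≤ l1 u / √k := by positivity
        linarith
      · push Not at hz
        have hne : (supp u).Nonempty := by
          rw [← Finset.card_pos, (hs u).1]; omega
        obtain ⟨i₀, hi₀⟩ := hne
        have hlt : {i | restrict (supp u)ᶜ u i ≠ 0}.ncard < {i | u i ≠ 0}.ncard := by
          refine Set.ncard_lt_ncard ?_ (Set.toFinite _)
          refine ⟨fun i hi => ?_, fun h => ?_⟩
          · by_contra h0
            simp only [Set.mem_ofPred_eq, not_not] at h0
            exact hi (by simp [restrict, h0])
          · have := h (hz i₀ hi₀)
            simp [restrict, hi₀] at this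
        have h2 := ih _ (hlt.trans_le hn) (restrict (supp u)ᶜ u) _ le_rfl (hsplit u)
          (div_nonneg (Finset.sum_nonneg fun i _ => abs_nonneg _) hk0.le)
        have h3 := hadd (restrict (supp u) u) (restrict (supp u)ᶜ u)
        rw [restrict_add_restrict_compl] at h3
        rw [hdiv, ← add_div, hl1] at h2
        linarith
  -- The first block is measured by its `l2` norm instead of a sup bound; this is the only source of
  -- the `l2` term.
  have h2 := hsup _ (restrict (supp u)ᶜ u) _ le_rfl (hsplit u)
    (div_nonneg (Finset.sum_nonneg fun i _ => abs_nonneg _) hk0.le)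
  have h3 := hadd (restrict (supp u) u) (restrict (supp u)ᶜ u)
  rw [restrict_add_restrict_compl] at h3
  rw [hdiv, ← add_div, hl1] at h2
  have h5 : g (restrict (supp u) u) ≤ c * l2 u :=
    (hg _ (isSparse_restrict (hs u).1.le u)).trans (by gcongr; exact l2_restrict_le _ _)
  linarith

end Restriction

/-- `I - Mᵀ M` is small between the images under `Ωᵀ` and `Ω†` of `2k`-sparse vectors, and `M Ωᵀ`
is bounded on `2k`-sparse vectors. -/
structure RestrictedContraction {m p d : ℕ} (k : ℕ) (B : ℝ) (Ω : Matrix (Fin p) (Fin d) ℝ)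
    (M : Matrix (Fin m) (Fin d) ℝ) : Prop where
  contraction : ∀ u h : Fin p → ℝ, IsSparse (2 * k) u → IsSparse (2 * k) h →
    |(Ωᵀ *ᵥ u) ⬝ᵥ (pinv Ω *ᵥ h) - (M *ᵥ (Ωᵀ *ᵥ u)) ⬝ᵥ (M *ᵥ (pinv Ω *ᵥ h))|
      ≤ 1 / 4 * (l2 u * l2 h)
  bound : ∀ u : Fin p → ℝ, IsSparse (2 * k) u → l2 (M *ᵥ (Ωᵀ *ᵥ u)) ≤ 2 * B * l2 u

/-! ### Convergence of the iteration under the restricted contraction -/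

section Deterministic

variable {m p d : ℕ} {k : ℕ} {A B : ℝ} {Ω : Matrix (Fin p) (Fin d) ℝ}
  {M : Matrix (Fin m) (Fin d) ℝ}

theorem IsFrame.nonneg (hΩ : IsFrame Ω A B) : 0 ≤ B := (norm_nonneg _).trans hΩ.norm_le

theorem IsFrame.l2_transpose_mulVec_le (hΩ : IsFrame Ω A B) (u : Fin p → ℝ) :
    l2 (Ωᵀ *ᵥ u) ≤ B * l2 u :=
  (TDIHT.l2_transpose_mulVec_le Ω u).trans
    (mul_le_mul_of_nonneg_right hΩ.norm_le (l2_nonneg u))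

theorem IsFrame.l2_pinv_mulVec_le (hΩ : IsFrame Ω A B) (h : Fin p → ℝ) :
    l2 (pinv Ω *ᵥ h) ≤ 1 / A * l2 h :=
  (l2_mulVec_le _ h).trans (mul_le_mul_of_nonneg_right hΩ.norm_pinv_le (l2_nonneg h))

theorem IsFrame.pinv_mulVec_mulVec (hΩ : IsFrame Ω A B) (x : Fin d → ℝ) :
    pinv Ω *ᵥ (Ω *ᵥ x) = x := by
  rw [Matrix.mulVec_mulVec, (pinv_penrose hΩ.injective).1, Matrix.one_mulVec]

/-- `Ω† Ω = 1` forces `1 ≤ ‖Ω†‖ ‖Ω‖ ≤ B / A` once there is a nonzero vector. For `d = 0` even `B =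
0` is possible, so that dimension is treated apart throughout. -/
theorem IsFrame.le (hΩ : IsFrame Ω A B) (hd : 0 < d) : A ≤ B := by
  have hA := hΩ.pos
  let x : Fin d → ℝ := Pi.single ⟨0, hd⟩ 1
  have hx : l2 x ^ 2 = 1 := by simp [l2_sq, x]
  have hx0 : 0 < l2 x := by
    rcases (l2_nonneg x).lt_or_eq with h | h
    · exact h
    · rw [← h] at hx; norm_num at hx
  have h1 := hΩ.l2_pinv_mulVec_le (Ω *ᵥ x)
  rw [hΩ.pinv_mulVec_mulVec] at h1
  have h2 : l2 (Ω *ᵥ x) ≤ B * l2 x :=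
    (l2_mulVec_le Ω x).trans (mul_le_mul_of_nonneg_right hΩ.norm_le (l2_nonneg x))
  have h3 : l2 x ≤ B / A * l2 x := by
    refine h1.trans ?_
    calc 1 / A * l2 (Ω *ᵥ x) ≤ 1 / A * (B * l2 x) := by gcongr
      _ = B / A * l2 x := by ring
  have h4 : 1 ≤ B / A := by
    by_contra! h
    nlinarith
  rwa [le_div_iff₀ hA, one_mul] at h4

theorem restrict_dotProduct_mulVec (S : Finset (Fin p)) (Ω : Matrix (Fin p) (Fin d) ℝ)
    (q : Fin d → ℝ) :
    l2 (restrict S (Ω *ᵥ q)) ^ 2 = (Ωᵀ *ᵥ restrict S (Ω *ᵥ q)) ⬝ᵥ q := by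
  rw [l2_sq, restrict_dotProduct, Matrix.dotProduct_mulVec, Matrix.mulVec_transpose]

/-- Testing the restricted vector against itself turns its squared norm into the bilinear form of
`RestrictedContraction`, with the vector itself as the sparse `u`. -/
theorem RestrictedContraction.l2_restrict_le (hM : RestrictedContraction k B Ω M)
    {S : Finset (Fin p)} (hS : S.card ≤ 2 * k) {h : Fin p → ℝ} (hh : IsSparse (2 * k) h) :
    l2 (restrict S (Ω *ᵥ (pinv Ω *ᵥ h - Mᵀ *ᵥ (M *ᵥ (pinv Ω *ᵥ h))))) ≤ 1 / 4 * l2 h := by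
  have := l2_nonneg h
  refine l2_le_of_sq_le_mul (by positivity) ?_
  rw [restrict_dotProduct_mulVec]
  set u := restrict S (Ω *ᵥ (pinv Ω *ᵥ h - Mᵀ *ᵥ (M *ᵥ (pinv Ω *ᵥ h))))
  have h1 := hM.contraction u h (isSparse_restrict hS _) hh
  have h2 : (M *ᵥ (Ωᵀ *ᵥ u)) ⬝ᵥ (M *ᵥ (pinv Ω *ᵥ h))
      = (Ωᵀ *ᵥ u) ⬝ᵥ (Mᵀ *ᵥ (M *ᵥ (pinv Ω *ᵥ h))) := by
    rw [Matrix.dotProduct_mulVec _ Mᵀ, Matrix.vecMul_transpose]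
  rw [h2, ← dotProduct_sub] at h1
  have := (le_abs_self _).trans h1
  linarith

theorem RestrictedContraction.l2_restrict_noise_le (hM : RestrictedContraction k B Ω M)
    (hB : 0 ≤ B) {S : Finset (Fin p)} (hS : S.card ≤ 2 * k) (e : Fin m → ℝ) :
    l2 (restrict S (Ω *ᵥ (Mᵀ *ᵥ e))) ≤ 2 * B * l2 e := by
  have := l2_nonneg e
  refine l2_le_of_sq_le_mul (by positivity) ?_
  rw [restrict_dotProduct_mulVec]
  set u := restrict S (Ω *ᵥ (Mᵀ *ᵥ e)) with hu
  have h1 := hM.bound u (isSparse_restrict hS _)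
  rw [Matrix.dotProduct_mulVec _ Mᵀ, Matrix.vecMul_transpose]
  refine (le_abs_self _).trans ((abs_dotProduct_le _ _).trans ?_)
  calc l2 (M *ᵥ (Ωᵀ *ᵥ u)) * l2 e ≤ (2 * B * l2 u) * l2 e := by gcongr
    _ = _ := by ring

variable {supp : (Fin p → ℝ) → Finset (Fin p)}

/-- Handles the tail of `Ω x`, which need not be sparse: the left side is subadditive in `h`, so the
block decomposition applies. -/
theorem RestrictedContraction.l2_restrict_le_l1 (hM : RestrictedContraction k B Ω M) (hk : 1 ≤ k)
    (hs : IsSuppRule k supp) {S : Finset (Fin p)} (hS : S.card ≤ 2 * k) (h : Fin p → ℝ) :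
    l2 (restrict S (Ω *ᵥ (pinv Ω *ᵥ h - Mᵀ *ᵥ (M *ᵥ (pinv Ω *ᵥ h)))))
      ≤ 1 / 4 * (l2 h + l1 h / √k) := by
  refine le_l2_add_l1_of_isSparse hk hs
    (g := fun h => l2 (restrict S (Ω *ᵥ (pinv Ω *ᵥ h - Mᵀ *ᵥ (M *ᵥ (pinv Ω *ᵥ h))))))
    (fun u v => ?_) (by norm_num)
    (fun u hu => hM.l2_restrict_le hS (hu.mono (by omega))) h
  refine le_trans (le_of_eq ?_) (l2_add_le _ _)
  rw [← restrict_add, ← Matrix.mulVec_add]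
  simp only [Matrix.mulVec_add, Matrix.mulVec_sub]
  congr 2
  abel

theorem iter_support (hs : IsSuppRule k supp) (y : Fin m → ℝ) (t : ℕ) :
    ∃ S : Finset (Fin p), S.card ≤ k ∧ ∀ i ∉ S, iter M Ω supp y t i = 0 := by
  cases t with
  | zero => exact ⟨∅, by simp, fun i _ => rfl⟩
  | succ t => exact ⟨_, (hs _).1.le, fun i hi => by rw [iter, restrict, if_neg hi]⟩

/-- The error of TDIHT in the transform domain, relative to the largest entries of `Ω x`. -/
theorem RestrictedContraction.l2_iter_sub_le (hM : RestrictedContraction k B Ω M) (hk : 1 ≤ k)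
    (hinj : Function.Injective Ω.mulVec) (hs : IsSuppRule k supp) {x : Fin d → ℝ}
    {T : Finset (Fin p)} (hT : T.card = k) {e : Fin m → ℝ} {ν : ℝ}
    (hν : ∀ S : Finset (Fin p), S.card ≤ 2 * k → l2 (restrict S (Ω *ᵥ (Mᵀ *ᵥ e))) ≤ ν) (t : ℕ) :
    l2 (iter M Ω supp (M *ᵥ x + e) t - restrict T (Ω *ᵥ x)) ≤
      (1 / 2) ^ t * l2 (restrict T (Ω *ᵥ x)) + 2 * (2 * ν +
        (5 / 2 * l2 (restrict Tᶜ (Ω *ᵥ x)) + 1 / 2 * (l1 (restrict Tᶜ (Ω *ᵥ x)) / √k))) := by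
  set w := Ω *ᵥ x with hw
  set r := restrict Tᶜ w with hr
  -- One iteration takes an error bound `a` to `a / 2 + b`, and `2 * b` is the fixed point.
  -- Thresholding doubles every term: `5/2 = 2 (1 + 1/4)` comes from `r` and `F r`, and `1/2 = 2 ·
  -- 1/4` from `F r` alone.
  set b := 2 * ν + (5 / 2 * l2 r + 1 / 2 * (l1 r / √k)) with hb
  have hν0 : 0 ≤ ν := (l2_nonneg _).trans (hν ∅ (by simp))
  have hb0 : 0 ≤ b := by
    have h1 := l2_nonneg r
    have h2 : 0 ≤ l1 r := Finset.sum_nonneg fun i _ => abs_nonneg _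
    positivity
  induction t with
  | zero => simp only [iter, zero_sub, l2_neg]; linarith
  | succ t ih =>
    obtain ⟨S₀, hS₀, hS₀'⟩ := iter_support (M := M) (Ω := Ω) hs (M *ᵥ x + e) t
    set z := iter M Ω supp (M *ᵥ x + e) t with hz
    set g := gradStep M Ω (M *ᵥ x + e) z with hg
    set F : (Fin p → ℝ) → Fin p → ℝ :=
      fun h => Ω *ᵥ (pinv Ω *ᵥ h - Mᵀ *ᵥ (M *ᵥ (pinv Ω *ᵥ h))) with hF
    have hxw : pinv Ω *ᵥ w = x := by
      rw [hw, Matrix.mulVec_mulVec, (pinv_penrose hinj).1, Matrix.one_mulVec]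
    have hwT : w = restrict T w + r := (restrict_add_restrict_compl T w).symm
    have hFsub : ∀ u v, F (u - v) = F u - F v := by
      intro u v
      simp only [hF, Matrix.mulVec_sub]
      abel
    have hFw : F w = w - Ω *ᵥ (Mᵀ *ᵥ (M *ᵥ x)) := by
      change Ω *ᵥ (pinv Ω *ᵥ w - Mᵀ *ᵥ (M *ᵥ (pinv Ω *ᵥ w))) = _
      rw [hxw, Matrix.mulVec_sub, ← hw]
    have hgz : g = F z + Ω *ᵥ (Mᵀ *ᵥ (M *ᵥ x)) + Ω *ᵥ (Mᵀ *ᵥ e) := by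
      simp only [hg, gradStep, hF, Matrix.mulVec_sub, Matrix.mulVec_add]
      abel
    -- Only `z - restrict T w`, which is `2k`-sparse, is fed to the contraction; `r` reappears by
    -- itself because `F w = w - Ω Mᵀ M x` still contains it.
    have hg2 : g - restrict T w = F (z - restrict T w) - F r + (r + Ω *ᵥ (Mᵀ *ᵥ e)) := by
      have h1 : F w = F (restrict T w) + F r := by
        have := hFsub w r
        rw [show w - r = restrict T w from sub_eq_of_eq_add hwT] at this
        rw [this]; abel
      rw [hgz, hFsub]
      have h2 : Ω *ᵥ (Mᵀ *ᵥ (M *ᵥ x)) = restrict T w + r - F (restrict T w) - F r := by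
        rw [← hwT, sub_sub, ← h1, hFw]; abel
      rw [h2]; abel
    have h1 := l2_restrict_topK_sub_le (hs g) hT
      (fun i hi => by simp [restrict, hi] : ∀ i ∉ T, restrict T w i = 0)
    have hcard : (T ∪ supp g).card ≤ 2 * k := by
      have := Finset.card_union_le T (supp g)
      have := (hs g).1
      omega
    have h2 : l2 (restrict (T ∪ supp g) (F (z - restrict T w)))
        ≤ 1 / 4 * l2 (z - restrict T w) := by
      refine hM.l2_restrict_le hcard (isSparse_of_support_subset (T := S₀ ∪ T) ?_ fun i hi => ?_)
      · have := Finset.card_union_le S₀ T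
        omega
      · rw [Finset.mem_union, not_or] at hi
        simp [hS₀' i hi.1, restrict, hi.2]
    have h3 : l2 (restrict (T ∪ supp g) (F r)) ≤ 1 / 4 * (l2 r + l1 r / √k) :=
      hM.l2_restrict_le_l1 hk hs hcard r
    have h4 := TDIHT.l2_restrict_le (T ∪ supp g) r
    have h5 := hν _ hcard
    rw [hg2, restrict_add, restrict_sub, restrict_add] at h1
    have h6 := l2_add_le (restrict (T ∪ supp g) (F (z - restrict T w))
      - restrict (T ∪ supp g) (F r))
      (restrict (T ∪ supp g) r + restrict (T ∪ supp g) (Ω *ᵥ (Mᵀ *ᵥ e)))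
    have h7 := l2_sub_le (restrict (T ∪ supp g) (F (z - restrict T w)))
      (restrict (T ∪ supp g) (F r))
    have h8 := l2_add_le (restrict (T ∪ supp g) r) (restrict (T ∪ supp g) (Ω *ᵥ (Mᵀ *ᵥ e)))
    have h9 : iter M Ω supp (M *ᵥ x + e) (t + 1) = restrict (supp g) g := rfl
    rw [h9, pow_succ]
    linarith

theorem mismatch_nonneg (hA : 0 < A) (u : Fin p → ℝ) : 0 ≤ mismatch A k u := by
  have h1 := l2_nonneg u
  have h2 : 0 ≤ l1 u := Finset.sum_nonneg fun i _ => abs_nonneg _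
  unfold mismatch
  positivity

/-- The iteration only needs the prefactor `1 / A`, which is smaller than `(1 + A) / A ^ 2`. -/
theorem le_mismatch (hA : 0 < A) (u : Fin p → ℝ) :
    1 / A * (l2 u + l1 u / √k) ≤ mismatch A k u := by
  have h1 := l2_nonneg u
  have h2 : 0 ≤ l1 u := Finset.sum_nonneg fun i _ => abs_nonneg _
  have e : mismatch A k u = (1 + A) / A ^ 2 * (l2 u + l1 u / √k) := by
    unfold mismatch
    rw [mul_add, div_mul_eq_div_div]
    ring
  have h3 : 1 / A ≤ (1 + A) / A ^ 2 := by
    rw [div_le_div_iff₀ hA (by positivity)]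
    nlinarith
  rw [e]
  exact mul_le_mul_of_nonneg_right h3 (by positivity)

/-- The error of the output of TDIHT, in terms of the noise that the gradient step sees. -/
theorem RestrictedContraction.l2_sub_output_le (hM : RestrictedContraction k B Ω M) (hk : 1 ≤ k)
    (hΩ : IsFrame Ω A B) (hs : IsSuppRule k supp) {x : Fin d → ℝ}
    {T : Finset (Fin p)} (hT : T.card = k) {e : Fin m → ℝ} {ν : ℝ}
    (hν : ∀ S : Finset (Fin p), S.card ≤ 2 * k → l2 (restrict S (Ω *ᵥ (Mᵀ *ᵥ e))) ≤ ν) (t : ℕ) :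
    l2 (x - output M Ω supp (M *ᵥ x + e) t) ≤
      1 / A * ((1 / 2) ^ t * l2 (restrict T (Ω *ᵥ x)) + 4 * ν)
        + 6 * mismatch A k (restrict Tᶜ (Ω *ᵥ x)) := by
  have hA := hΩ.pos
  have h1 := hM.l2_iter_sub_le hk hΩ.injective hs hT hν t (x := x)
  have h2 := hΩ.l2_pinv_mulVec_le (Ω *ᵥ x - iter M Ω supp (M *ᵥ x + e) t)
  rw [Matrix.mulVec_sub, hΩ.pinv_mulVec_mulVec] at h2
  have h3 := le_mismatch (k := k) hA (restrict Tᶜ (Ω *ᵥ x))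
  set r := restrict Tᶜ (Ω *ᵥ x) with hr
  have h4 : l2 (Ω *ᵥ x - iter M Ω supp (M *ᵥ x + e) t)
      ≤ l2 r + l2 (iter M Ω supp (M *ᵥ x + e) t - restrict T (Ω *ᵥ x)) := by
    refine le_trans (le_of_eq ?_) (l2_sub_le _ _)
    congr 1
    conv_lhs => rw [← restrict_add_restrict_compl T (Ω *ᵥ x)]
    abel
  have h5 : 0 ≤ l1 r / √k := div_nonneg (Finset.sum_nonneg fun i _ => abs_nonneg _) (by positivity)
  have h6 := l2_nonneg r
  -- The factor `6` is `1` for the tail that the target `restrict T (Ω *ᵥ x)` omits, plus `5 = 2 ·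
  -- 5/2` from the iteration.
  refine h2.trans ?_
  calc 1 / A * l2 (Ω *ᵥ x - iter M Ω supp (M *ᵥ x + e) t)
      ≤ 1 / A * (((1 / 2) ^ t * l2 (restrict T (Ω *ᵥ x)) + 4 * ν) + 6 * (l2 r + l1 r / √k)) := by
        gcongr
        linarith
    _ ≤ _ := by linarith

theorem RestrictedContraction.stableRecovery (hM : RestrictedContraction k B Ω M) (hk : 1 ≤ k)
    (hΩ : IsFrame Ω A B) {C : ℝ} (hC : 9 ≤ C) : StableRecovery C k A B Ω M := by
  intro supp hs x T hT e η t hη ht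
  have hA := hΩ.pos
  have hB := hΩ.nonneg
  have h := hM.l2_sub_output_le hk hΩ hs hT.1
    (fun S hS => hM.l2_restrict_noise_le hB hS e) t (x := x)
  have h0 := mismatch_nonneg (k := k) hA (restrict Tᶜ (Ω *ᵥ x))
  have he := l2_nonneg e
  refine h.trans ?_
  calc _ ≤ 1 / A * ((B * l2 e + η) + 4 * (2 * B * l2 e))
        + 6 * mismatch A k (restrict Tᶜ (Ω *ᵥ x)) := by gcongr
    _ = 1 * (η / A) + 9 * (B / A * l2 e) + 6 * mismatch A k (restrict Tᶜ (Ω *ᵥ x)) := by ring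
    _ ≤ C * (η / A) + C * (B / A * l2 e) + C * mismatch A k (restrict Tᶜ (Ω *ᵥ x)) := by
        gcongr <;> linarith
    _ = _ := by ring

/-- The D-RIP for the dictionary `[P Ω†, P Ωᵀ]` yields near preservation of inner products. -/
theorem HasDRIP.abs_dotProduct_sub_le {n : ℕ} {E F : Matrix (Fin d) (Fin p) ℝ}
    {G : Matrix (Fin n) (Fin d) ℝ} {δ : ℝ} (h : HasDRIP G (Matrix.fromCols E F) (4 * k) δ)
    {u v : Fin p → ℝ} (hu : IsSparse (2 * k) u) (hv : IsSparse (2 * k) v) :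
    |(F *ᵥ u) ⬝ᵥ (E *ᵥ v) - (G *ᵥ (F *ᵥ u)) ⬝ᵥ (G *ᵥ (E *ᵥ v))|
      ≤ δ * (l2 (F *ᵥ u) * l2 (E *ᵥ v)) := by
  refine TDIHT.abs_dotProduct_sub_le G fun r s => ?_
  -- The combination `r • F u + s • E v` has one coefficient vector with `2k + 2k` nonzero entries,
  -- hence the order `4k`.
  have hsp : IsSparse (4 * k) (Sum.elim (s • v) (r • u)) := by
    have hsub : {i | Sum.elim (s • v) (r • u) i ≠ 0}
        ⊆ Sum.inl '' {i | v i ≠ 0} ∪ Sum.inr '' {i | u i ≠ 0} := by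
      rintro (i | i) hi
      · left; exact ⟨i, fun h0 => hi (by simp [h0]), rfl⟩
      · right; exact ⟨i, fun h0 => hi (by simp [h0]), rfl⟩
    refine (Set.ncard_le_ncard hsub (Set.toFinite _)).trans ((Set.ncard_union_le _ _).trans ?_)
    rw [Set.ncard_image_of_injective _ Sum.inl_injective,
      Set.ncard_image_of_injective _ Sum.inr_injective]
    unfold IsSparse at hu hv
    omega
  have e : Matrix.fromCols E F *ᵥ (Sum.elim (s • v) (r • u)) = r • F *ᵥ u + s • E *ᵥ v := by
    rw [Matrix.fromCols_mulVec]
    simp [Matrix.mulVec_smul, add_comm]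
  have h1 := h _ hsp
  rw [e] at h1
  rw [abs_le]
  constructor <;> linarith [h1.1, h1.2]

theorem HasDRIP.l2_sq_le {n : ℕ} {E F : Matrix (Fin d) (Fin p) ℝ}
    {G : Matrix (Fin n) (Fin d) ℝ} {δ : ℝ} (h : HasDRIP G (Matrix.fromCols E F) (4 * k) δ)
    {u : Fin p → ℝ} (hu : IsSparse (2 * k) u) :
    l2 (G *ᵥ (F *ᵥ u)) ^ 2 ≤ (1 + δ) * l2 (F *ᵥ u) ^ 2 := by
  have hsp : IsSparse (4 * k) (Sum.elim (0 : Fin p → ℝ) u) := by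
    have hsub : {i | Sum.elim (0 : Fin p → ℝ) u i ≠ 0} ⊆ Sum.inr '' {i | u i ≠ 0} := by
      rintro (i | i) hi
      · exact absurd rfl hi
      · exact ⟨i, hi, rfl⟩
    refine (Set.ncard_le_ncard hsub (Set.toFinite _)).trans ?_
    rw [Set.ncard_image_of_injective _ Sum.inr_injective]
    unfold IsSparse at hu
    omega
  have e : Matrix.fromCols E F *ᵥ (Sum.elim (0 : Fin p → ℝ) u) = F *ᵥ u := by
    rw [Matrix.fromCols_mulVec]
    simp
  have h1 := (h _ hsp).2
  rwa [e] at h1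

theorem RestrictedContraction.of_dim_zero (Ω : Matrix (Fin p) (Fin 0) ℝ)
    (M : Matrix (Fin m) (Fin 0) ℝ) (hB : 0 ≤ B) : RestrictedContraction k B Ω M where
  contraction u h _ _ := by
    have := mul_nonneg (l2_nonneg u) (l2_nonneg h)
    rw [Subsingleton.elim (Ωᵀ *ᵥ u) 0]
    simp
    linarith
  bound u _ := by
    have := l2_nonneg u
    rw [Subsingleton.elim (Ωᵀ *ᵥ u) 0]
    simp
    positivity

/-- The constant is chosen so that `A / (4B) · B · (1 / A) = 1/4`. -/
theorem HasDRIP.restrictedContraction (hΩ : IsFrame Ω A B)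
    (h : HasDRIP M (Matrix.fromCols (pinv Ω) Ωᵀ) (4 * k) (A / (4 * B))) :
    RestrictedContraction k B Ω M := by
  have hA := hΩ.pos
  rcases Nat.eq_zero_or_pos d with rfl | hd
  · exact .of_dim_zero Ω M hΩ.nonneg
  have hAB := hΩ.le hd
  have hB : 0 < B := hA.trans_le hAB
  constructor
  · intro u v hu hv
    refine (h.abs_dotProduct_sub_le hu hv).trans ?_
    have h1 := hΩ.l2_transpose_mulVec_le u
    have h2 := hΩ.l2_pinv_mulVec_le v
    have := l2_nonneg (pinv Ω *ᵥ v)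
    have := l2_nonneg u
    calc A / (4 * B) * (l2 (Ωᵀ *ᵥ u) * l2 (pinv Ω *ᵥ v))
        ≤ A / (4 * B) * ((B * l2 u) * (1 / A * l2 v)) := by gcongr
      _ = _ := by field_simp
  · intro u hu
    have h1 := hΩ.l2_transpose_mulVec_le u
    have h2 := h.l2_sq_le hu
    have h3 : A / (4 * B) ≤ 1 := by
      rw [div_le_one (by positivity)]; linarith
    have := l2_nonneg u
    have := l2_nonneg (Ωᵀ *ᵥ u)
    refine (sq_le_sq₀ (l2_nonneg _) (by positivity)).mp ?_
    calc _ ≤ _ := h2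
      _ ≤ (1 + 1) * (B * l2 u) ^ 2 := by gcongr
      _ ≤ (2 * B * l2 u) ^ 2 := by nlinarith [sq_nonneg (B * l2 u)]

end Deterministic

/-! ### Exponential moments of squares and maxima of sub-Gaussian variables -/

section Subgaussian

variable {S : Type*} [MeasurableSpace S] {μ : Measure S}

theorem hasSubgaussianMGF_mono {X : S → ℝ} {c c' : ℝ≥0} (h : HasSubgaussianMGF X c μ)
    (hc : c ≤ c') : HasSubgaussianMGF X c' μ where
  integrable_exp_mul := h.integrable_exp_mul
  mgf_le t := (h.mgf_le t).trans (by gcongr)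

theorem hasSubgaussianMGF_sum_mul {ι : Type*} [Fintype ι] {X : ι → S → ℝ} (hX : iIndepFun X μ)
    {c : ℝ≥0} (h : ∀ i, HasSubgaussianMGF (X i) c μ) (a : ι → ℝ) {b : ℝ≥0}
    (hb : l2 a ^ 2 * c ≤ b) : HasSubgaussianMGF (fun s => ∑ i, a i * X i s) b μ := by
  have h1 := HasSubgaussianMGF.sum_of_iIndepFun (s := Finset.univ)
    (hX.comp (fun i x => a i * x) (fun i => by fun_prop))
    (fun i _ => (h i).const_mul (a i))
  refine hasSubgaussianMGF_mono h1 ?_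
  rw [← NNReal.coe_le_coe]
  push_cast
  rw [l2_sq_eq_sum, Finset.sum_mul] at hb
  exact hb

theorem hasSubgaussianMGF_id_gaussianReal (v : ℝ≥0) :
    HasSubgaussianMGF id v (gaussianReal 0 v) where
  integrable_exp_mul t := integrable_exp_mul_gaussianReal t
  mgf_le t := by simp [mgf_id_gaussianReal]

theorem lintegral_exp_sq_gaussianReal {c : ℝ≥0} (hc : 0 < c) :
    ∫⁻ g, ENNReal.ofReal (Real.exp (c * g ^ 2 / 2)) ∂gaussianReal 0 (1 / (2 * c))
      = ENNReal.ofReal √2 := by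
  have hc' : (0 : ℝ) < c := hc
  have hv : (1 / (2 * c) : ℝ≥0) ≠ 0 := by positivity
  have key : ∀ g : ℝ, gaussianPDFReal 0 (1 / (2 * c)) g * Real.exp (c * g ^ 2 / 2)
      = √(c / Real.pi) * Real.exp (-(c / 2) * g ^ 2) := by
    intro g
    rw [gaussianPDFReal_def, mul_assoc, ← Real.exp_add]
    congr 1
    · rw [← Real.sqrt_inv]
      congr 1
      push_cast
      field_simp
    · congr 1
      push_cast
      field_simp
      ring
  rw [gaussianReal_of_var_ne_zero _ hv,
    lintegral_withDensity_eq_lintegral_mul _ (measurable_gaussianPDF _ _) (by fun_prop)]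
  have h2 : ∀ g : ℝ, (gaussianPDF 0 (1 / (2 * c)) *
      fun g : ℝ => ENNReal.ofReal (Real.exp (c * g ^ 2 / 2))) g
      = ENNReal.ofReal (√(c / Real.pi) * Real.exp (-(c / 2) * g ^ 2)) := by
    intro g
    rw [← key, ENNReal.ofReal_mul (gaussianPDFReal_nonneg _ _ _)]
    rfl
  simp_rw [h2]
  rw [← ofReal_integral_eq_lintegral_ofReal
    ((integrable_exp_neg_mul_sq (by positivity)).const_mul _)
    (ae_of_all _ fun g => by positivity), integral_const_mul, integral_gaussian,
    ← Real.sqrt_mul (by positivity)]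
  congr 2
  have := Real.pi_pos
  field_simp

/-- The square of a sub-Gaussian variable has an exponential moment. -/
theorem lintegral_exp_sq_le [SFinite μ] {X : S → ℝ} {c : ℝ≥0} (hc : 0 < c)
    (h : HasSubgaussianMGF X c μ) :
    ∫⁻ s, ENNReal.ofReal (Real.exp (X s ^ 2 / (4 * c))) ∂μ ≤ ENNReal.ofReal √2 := by
  have hc' : (0 : ℝ) < c := hc
  set γ := gaussianReal 0 (1 / (2 * c)) with hγ
  -- An auxiliary Gaussian `g` of variance `1 / (2c)` makes the exponent linear in `x`. After
  -- exchanging the integrals, the moment generating function of `X` is bounded by `exp (c g² / 2)`,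
  -- whose Gaussian mean is `√2`.
  have h1 : ∀ x : ℝ, ENNReal.ofReal (Real.exp (x ^ 2 / (4 * c)))
      = ∫⁻ g, ENNReal.ofReal (Real.exp (x * g)) ∂γ := by
    intro x
    rw [← ofReal_integral_eq_lintegral_ofReal (integrable_exp_mul_gaussianReal x)
      (ae_of_all _ fun g => by positivity)]
    have := congrFun (mgf_id_gaussianReal (μ := 0) (v := 1 / (2 * c))) x
    rw [mgf] at this
    simp only [id] at this
    rw [this]
    congr 2
    push_cast
    field_simp
    ring
  simp_rw [h1]
  rw [lintegral_lintegral_swap]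
  · rw [← lintegral_exp_sq_gaussianReal hc]
    refine lintegral_mono fun g => ?_
    have h2 : ∫⁻ s, ENNReal.ofReal (Real.exp (X s * g)) ∂μ = ENNReal.ofReal (mgf X μ g) := by
      rw [mgf, ofReal_integral_eq_lintegral_ofReal (h.integrable_exp_mul g)
        (ae_of_all _ fun g => by positivity)]
      simp_rw [mul_comm]
    rw [h2]
    exact ENNReal.ofReal_le_ofReal (h.mgf_le g)
  · have := h.aemeasurable
    have h3 : AEMeasurable (fun q : S × ℝ => X q.1) (μ.prod γ) := this.comp_fst
    exact ((h3.mul measurable_snd.aemeasurable).exp).ennreal_ofReal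

theorem integrable_exp_sq [SFinite μ] {X : S → ℝ} {c : ℝ≥0} (hc : 0 < c)
    (h : HasSubgaussianMGF X c μ) : Integrable (fun s => Real.exp (X s ^ 2 / (4 * c))) μ := by
  have hm : AEStronglyMeasurable (fun s => Real.exp (X s ^ 2 / (4 * c))) μ :=
    ((h.aemeasurable.pow_const 2).div_const _).exp.aestronglyMeasurable
  refine ⟨hm, ?_⟩
  rw [hasFiniteIntegral_iff_ofReal (ae_of_all _ fun s => by positivity)]
  exact (lintegral_exp_sq_le hc h).trans_lt ENNReal.ofReal_lt_top

theorem integral_exp_sq_le [SFinite μ] {X : S → ℝ} {c : ℝ≥0} (hc : 0 < c)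
    (h : HasSubgaussianMGF X c μ) : ∫ s, Real.exp (X s ^ 2 / (4 * c)) ∂μ ≤ 2 := by
  have h1 := lintegral_exp_sq_le hc h
  rw [← ofReal_integral_eq_lintegral_ofReal (integrable_exp_sq hc h)
    (ae_of_all _ fun s => by positivity), ENNReal.ofReal_le_ofReal_iff (by positivity)] at h1
  refine h1.trans ?_
  rw [Real.sqrt_le_left (by norm_num)]
  norm_num

/-- The expected maximum of the squares of `p` sub-Gaussian variables is of order `log p`. -/
theorem exists_integrable_sq_le [IsProbabilityMeasure μ] {p : ℕ} (hp : 2 ≤ p)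
    {X : Fin p → S → ℝ} {c : ℝ≥0} (h : ∀ i, HasSubgaussianMGF (X i) c μ) :
    ∃ Z : S → ℝ, Integrable Z μ ∧ (∀ᵐ s ∂μ, ∀ i, X i s ^ 2 ≤ Z s) ∧
      ∫ s, Z s ∂μ ≤ 16 * c * Real.log p := by
  have hlog : Real.log 2 ≤ Real.log p := Real.log_le_log (by norm_num) (by exact_mod_cast hp)
  have hlog2 := Real.log_two_gt_d9
  have hp0 : (0 : ℝ) < p := by positivity
  rcases eq_or_ne c 0 with rfl | hc
  · refine ⟨0, integrable_zero _ _ _, ?_, by simp⟩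
    filter_upwards [ae_all_iff.mpr fun i => (h i).ae_eq_zero_of_hasSubgaussianMGF_zero] with s hs i
    simp [hs i]
  have hc0 : 0 < c := pos_iff_ne_zero.mpr hc
  have hc' : (0 : ℝ) < c := hc0
  have hint : ∀ i ∈ Finset.univ, Integrable (fun s => Real.exp (X i s ^ 2 / (4 * c))) μ :=
    fun i _ => integrable_exp_sq hc0 (h i)
  -- A smooth majorant of the maximum, from `u ≤ log p + exp u / p` with `u = X i s ^ 2 / (4c)`. Its
  -- mean is at most `4c (log p + 2)`, and `2 ≤ 3 log p` holds because `p ≥ 2`.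
  refine ⟨fun s => 4 * c * (Real.log p + 1 / p * ∑ i, Real.exp (X i s ^ 2 / (4 * c))), ?_, ?_, ?_⟩
  · exact ((integrable_const _).add ((integrable_finsetSum _ hint).const_mul _)).const_mul _
  · refine ae_of_all _ fun s i => ?_
    have h1 : Real.exp (X i s ^ 2 / (4 * c)) ≤ ∑ i, Real.exp (X i s ^ 2 / (4 * c)) :=
      Finset.single_le_sum (f := fun i => Real.exp (X i s ^ 2 / (4 * c)))
        (fun i _ => (Real.exp_pos _).le) (Finset.mem_univ i)
    have h2 : X i s ^ 2 / (4 * c) ≤ Real.log p + 1 / p * Real.exp (X i s ^ 2 / (4 * c)) := by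
      have := Real.add_one_le_exp (X i s ^ 2 / (4 * c) - Real.log p)
      rw [Real.exp_sub, Real.exp_log hp0] at this
      have e : Real.exp (X i s ^ 2 / (4 * c)) / p = 1 / p * Real.exp (X i s ^ 2 / (4 * c)) := by
        ring
      linarith
    have h3 : X i s ^ 2 = 4 * c * (X i s ^ 2 / (4 * c)) := by field_simp
    rw [h3]
    refine mul_le_mul_of_nonneg_left (h2.trans ?_) (by positivity)
    gcongr
  · rw [integral_const_mul, integral_add (integrable_const _)
      ((integrable_finsetSum _ hint).const_mul _), integral_const_mul, integral_finsetSum _ hint]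
    have h4 : ∑ i, ∫ s, Real.exp (X i s ^ 2 / (4 * c)) ∂μ ≤ p * 2 := by
      refine (Finset.sum_le_sum fun i _ => integral_exp_sq_le hc0 (h i)).trans ?_
      simp
    have h5 : 1 / (p : ℝ) * ∑ i, ∫ s, Real.exp (X i s ^ 2 / (4 * c)) ∂μ ≤ 2 := by
      calc _ ≤ 1 / (p : ℝ) * (p * 2) := by gcongr
        _ = 2 := by field_simp
    simp only [integral_const, probReal_univ, one_smul]
    nlinarith

end Subgaussian

/-! ### Gaussian noise -/

section Denoising

variable {m p d : ℕ} {k : ℕ} {A B : ℝ} {Ω : Matrix (Fin p) (Fin d) ℝ}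
  {M : Matrix (Fin m) (Fin d) ℝ} {supp : (Fin p → ℝ) → Finset (Fin p)}

theorem measurable_restrict_supp (hs : ∀ S, MeasurableSet {w | supp w = S}) :
    Measurable fun w => restrict (supp w) w := by
  refine measurable_pi_lambda _ fun i => ?_
  have h : MeasurableSet {w | i ∈ supp w} := by
    have : {w | i ∈ supp w} = ⋃ S ∈ {S : Finset (Fin p) | i ∈ S}, {w | supp w = S} := by
      ext w; simp
    rw [this]
    exact MeasurableSet.biUnion (Set.to_countable _) fun S _ => hs S
  exact Measurable.ite h (measurable_pi_apply i) measurable_const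

theorem measurable_mulVec {ι κ : Type*} [Fintype ι] [Fintype κ] (X : Matrix ι κ ℝ) :
    Measurable X.mulVec :=
  (Continuous.matrix_mulVec continuous_const continuous_id).measurable

theorem measurable_iter (hs : ∀ S, MeasurableSet {w | supp w = S}) (t : ℕ) :
    Measurable fun y => iter M Ω supp y t := by
  induction t with
  | zero => exact measurable_const
  | succ t ih =>
    refine (measurable_restrict_supp hs).comp ?_
    unfold gradStep
    refine ((measurable_mulVec Ω).comp ((measurable_mulVec _).comp ih)).add
      ((measurable_mulVec Ω).comp ((measurable_mulVec _).comp (measurable_id.sub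
        ((measurable_mulVec _).comp ((measurable_mulVec _).comp ih)))))

theorem measurable_l2 {ι : Type*} [Fintype ι] : Measurable (l2 : (ι → ℝ) → ℝ) :=
  (continuous_norm.comp (PiLp.continuous_toLp 2 _)).measurable

theorem measurable_apply_nat {α : Type*} [MeasurableSpace α] {f : ℕ → α → ℝ}
    (hf : ∀ t, Measurable (f t)) {τ : α → ℕ} (hτ : Measurable τ) :
    Measurable fun e => f (τ e) e := by
  have h : Measurable fun q : α × ℕ => f q.2 q.1 := measurable_from_prod_countable_left hf
  exact h.comp (measurable_id.prodMk hτ)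

theorem measurable_l2_sub_output (hs : ∀ S, MeasurableSet {w | supp w = S}) (x : Fin d → ℝ)
    {τ : (Fin m → ℝ) → ℕ} (hτ : Measurable τ) :
    Measurable fun e => l2 (x - output M Ω supp (M *ᵥ x + e) (τ e)) := by
  refine measurable_apply_nat (f := fun t e => l2 (x - output M Ω supp (M *ᵥ x + e) t))
    (fun t => ?_) hτ
  have h1 : Measurable fun e : Fin m → ℝ => M *ᵥ x + e := measurable_const.add measurable_id
  have h2 : Measurable fun e => output M Ω supp (M *ᵥ x + e) t :=
    (measurable_mulVec (pinv Ω)).comp ((measurable_iter hs t).comp h1)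
  have h3 : Measurable fun e => x - output M Ω supp (M *ᵥ x + e) t := measurable_const.sub h2
  exact measurable_l2.comp h3

/-- Coordinate `i` is the inner product of `e` with `M Ωᵀ eᵢ`, where the unit vector `eᵢ` is sparse,
so this vector has norm at most `2B`. -/
theorem RestrictedContraction.hasSubgaussianMGF (hM : RestrictedContraction k B Ω M) (hk : 1 ≤ k)
    (σ : ℝ≥0) {c : ℝ≥0} (hc : (c : ℝ) = (2 * B) ^ 2 * σ ^ 2) (i : Fin p) :
    HasSubgaussianMGF (fun e => (Ω *ᵥ (Mᵀ *ᵥ e)) i) c (gaussianNoise m σ) := by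
  set a := M *ᵥ (Ωᵀ *ᵥ Pi.single i 1) with ha
  have h1 : l2 a ≤ 2 * B := by
    have hsp : IsSparse (2 * k) (Pi.single i (1 : ℝ)) :=
      isSparse_of_support_subset (T := {i}) (by simp; omega)
        fun j hj => Pi.single_eq_of_ne (by simpa using hj) _
    have h2 := hM.bound _ hsp
    have h3 : l2 (Pi.single i (1 : ℝ)) = 1 := by
      have : l2 (Pi.single i (1 : ℝ)) ^ 2 = 1 := by simp [l2_sq]
      exact (sq_eq_sq₀ (l2_nonneg _) zero_le_one).mp (by rw [this, one_pow])
    rwa [h3, mul_one] at h2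
  have h2 : (fun e => (Ω *ᵥ (Mᵀ *ᵥ e)) i) = fun e : Fin m → ℝ => ∑ j, a j * e j := by
    ext e
    have : (Ω *ᵥ (Mᵀ *ᵥ e)) i = Pi.single i 1 ⬝ᵥ (Ω *ᵥ (Mᵀ *ᵥ e)) := by simp
    rw [this, Matrix.dotProduct_mulVec, ← Matrix.mulVec_transpose, Matrix.dotProduct_mulVec,
      Matrix.vecMul_transpose]
    rfl
  rw [h2]
  refine hasSubgaussianMGF_sum_mul (c := σ ^ 2) (X := fun j (e : Fin m → ℝ) => e j) ?_ (fun j => ?_) a ?_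
  · exact iIndepFun_pi (X := fun _ x => x) fun _ => aemeasurable_id
  · exact HasSubgaussianMGF.of_map (X := id) (measurable_pi_apply j).aemeasurable (by
      rw [gaussianNoise, (measurePreserving_eval _ j).map_eq]
      exact hasSubgaussianMGF_id_gaussianReal _)
  · rw [hc]
    push_cast
    have := l2_nonneg a
    gcongr

/-- One variable `Z` dominates all squared noise coordinates, so `√(2kZ)` bounds the noise on every
set of `2k` positions at once. The pathwise estimate then holds for every iteration count, in
particular for `τ e`. -/
theorem RestrictedContraction.denoising (hM : RestrictedContraction k B Ω M) (hk : 1 ≤ k)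
    (hΩ : IsFrame Ω A B) (hp : 2 ≤ p) {C : ℝ} (hC : 9000 ≤ C) : Denoising C k A B Ω M := by
  intro supp hs hsm x T hT σ η τ hη hτ hiter
  have hA := hΩ.pos
  have hB := hΩ.nonneg
  have hprob : IsProbabilityMeasure (gaussianNoise m σ) := by
    unfold gaussianNoise; infer_instance
  obtain ⟨Z, hZ, hXZ, hZint⟩ := exists_integrable_sq_le hp
    (fun i => hM.hasSubgaussianMGF hk σ (c := ⟨(2 * B) ^ 2 * σ ^ 2, by positivity⟩) rfl i)
  have hlog : 0 ≤ Real.log p := Real.log_natCast_nonneg p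
  set r := mismatch A k (restrict Tᶜ (Ω *ᵥ x)) with hr
  have hr0 : 0 ≤ r := mismatch_nonneg hA _
  have hbound : ∀ᵐ e ∂gaussianNoise m σ,
      l2 (x - output M Ω supp (M *ᵥ x + e) (τ e)) ^ 2 ≤
        4 * ((η / A) ^ 2 + B ^ 2 / A ^ 2 * (k * Real.log p) * σ ^ 2 + 36 * r ^ 2)
          + 128 * k / A ^ 2 * Z e := by
    filter_upwards [hXZ, hiter] with e he hst
    have hZ0 : 0 ≤ Z e := (sq_nonneg _).trans (he ⟨0, by omega⟩)
    have hν : ∀ S : Finset (Fin p), S.card ≤ 2 * k →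
        l2 (restrict S (Ω *ᵥ (Mᵀ *ᵥ e))) ≤ √(2 * k * Z e) := by
      intro S hS
      refine Real.le_sqrt_of_sq_le ?_
      rw [l2_restrict_sq]
      refine (Finset.sum_le_sum fun i _ => he i).trans ?_
      rw [Finset.sum_const, nsmul_eq_mul]
      gcongr
      exact_mod_cast hS
    have h1 := hM.l2_sub_output_le hk hΩ hs hT.1 hν (τ e) (x := x)
    set q := √(k * Real.log p) with hq
    have hq2 : q ^ 2 = k * Real.log p := Real.sq_sqrt (by positivity)
    set ν := √(2 * k * Z e) with hνdef
    have hν2 : ν ^ 2 = 2 * k * Z e := Real.sq_sqrt (by positivity)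
    have h2 : l2 (x - output M Ω supp (M *ᵥ x + e) (τ e))
        ≤ η / A + B / A * q * σ + 4 / A * ν + 6 * r := by
      refine h1.trans ?_
      calc _ ≤ 1 / A * ((B * q * σ + η) + 4 * ν) + 6 * r := by gcongr
        _ = _ := by ring
    have h3 := pow_le_pow_left₀ (l2_nonneg _) h2 2
    refine h3.trans ?_
    have e1 : B ^ 2 / A ^ 2 * (k * Real.log p) * σ ^ 2 = (B / A * q * σ) ^ 2 := by
      rw [← hq2]; ring
    have e2 : 128 * k / A ^ 2 * Z e = 4 * (4 / A * ν) ^ 2 := by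
      rw [mul_pow, hν2]; ring
    rw [e1, e2]
    set a₁ := η / A
    set a₂ := B / A * q * σ
    set a₃ := 4 / A * ν
    nlinarith [sq_nonneg (a₁ - a₂), sq_nonneg (a₁ - a₃), sq_nonneg (a₁ - 6 * r),
      sq_nonneg (a₂ - a₃), sq_nonneg (a₂ - 6 * r), sq_nonneg (a₃ - 6 * r)]
  have hmeas : AEStronglyMeasurable
      (fun e => l2 (x - output M Ω supp (M *ᵥ x + e) (τ e)) ^ 2) (gaussianNoise m σ) :=
    ((measurable_l2_sub_output hsm x hτ).pow_const 2).aestronglyMeasurable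
  have hint : Integrable (fun e =>
      4 * ((η / A) ^ 2 + B ^ 2 / A ^ 2 * (k * Real.log p) * σ ^ 2 + 36 * r ^ 2)
          + 128 * k / A ^ 2 * Z e) (gaussianNoise m σ) :=
    (integrable_const _).add (hZ.const_mul _)
  have hI : Integrable (fun e => l2 (x - output M Ω supp (M *ᵥ x + e) (τ e)) ^ 2)
      (gaussianNoise m σ) := by
    refine hint.mono' hmeas ?_
    filter_upwards [hbound] with e he
    rwa [Real.norm_of_nonneg (sq_nonneg _)]
  refine ⟨hI, (integral_mono_ae hI hint hbound).trans ?_⟩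
  rw [integral_add (integrable_const _) (hZ.const_mul _),
    integral_const_mul (128 * k / A ^ 2) Z]
  simp only [integral_const, probReal_univ, one_smul]
  have hZ' : ∫ e, Z e ∂gaussianNoise m σ ≤ 16 * ((2 * B) ^ 2 * σ ^ 2) * Real.log p := hZint
  set s := B ^ 2 / A ^ 2 * (k * Real.log p) * σ ^ 2 with hs'
  have hs0 : 0 ≤ s := by positivity
  -- `128 = 4 · 4² · 2` comes from squaring a sum of four terms, the factor `4` on `ν`, and `ν ^ 2 =
  -- 2 * k * Z e`; `8192 = 128 · 16 · 4`.
  have h4 : 128 * k / A ^ 2 * ∫ e, Z e ∂gaussianNoise m σ ≤ 8192 * s := by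
    calc _ ≤ 128 * k / A ^ 2 * (16 * ((2 * B) ^ 2 * σ ^ 2) * Real.log p) := by gcongr
      _ = _ := by rw [hs']; ring
  have h5 : 0 ≤ (η / A) ^ 2 := sq_nonneg _
  have h6 : 0 ≤ r ^ 2 := sq_nonneg _
  calc _ ≤ 9000 * ((η / A) ^ 2 + s + r ^ 2) := by linarith
    _ ≤ _ := by gcongr

theorem RestrictedContraction.guarantee (hM : RestrictedContraction k B Ω M) (hk : 1 ≤ k)
    (hΩ : IsFrame Ω A B) {C : ℝ} (hC : 9000 ≤ C) : Guarantee C k A B Ω M :=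
  ⟨hM.stableRecovery hk hΩ (by linarith), fun hp => hM.denoising hk hΩ hp hC⟩

end Denoising

/-! ### Bernstein inequality and concentration of `‖M v‖²` -/

section Bernstein

theorem exp_le_one_add_add (x : ℝ) : Real.exp x ≤ 1 + x + x ^ 2 * Real.exp |x| := by
  have h := Complex.norm_exp_sub_sum_le_norm_mul_exp (x : ℂ) 2
  have e : Complex.exp x - ∑ m ∈ Finset.range 2, (x : ℂ) ^ m / m.factorial
      = ((Real.exp x - (1 + x) : ℝ) : ℂ) := by
    simp [Finset.sum_range_succ]
  rw [e, Complex.norm_real, Complex.norm_real, Real.norm_eq_abs, Real.norm_eq_abs, sq_abs] at h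
  linarith [le_abs_self (Real.exp x - (1 + x))]

theorem exp_quarter_le : Real.exp (1 / 4) ≤ 2 := by
  have h := Real.one_sub_le_exp_neg (1 / 4)
  rw [Real.exp_neg] at h
  have h0 := Real.exp_pos (1 / 4)
  have : Real.exp (1 / 4) * (3 / 4) ≤ 1 := by
    calc _ ≤ Real.exp (1 / 4) * (Real.exp (1 / 4))⁻¹ := by gcongr; linarith
      _ = 1 := mul_inv_cancel₀ h0.ne'
  linarith

variable {S : Type*} [MeasurableSpace S] {μ : Measure S} [IsProbabilityMeasure μ]

theorem exp_abs_sq_sub_one_le {c : ℝ} (hc : 1 ≤ c) (y : ℝ) :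
    Real.exp (|y ^ 2 - 1| / (4 * c)) ≤ 2 * Real.exp (y ^ 2 / (4 * c)) := by
  have h1 : |y ^ 2 - 1| ≤ y ^ 2 + 1 := by
    rw [abs_le]; constructor <;> nlinarith [sq_nonneg y]
  calc Real.exp (|y ^ 2 - 1| / (4 * c)) ≤ Real.exp (1 / 4 + y ^ 2 / (4 * c)) := by
        refine Real.exp_le_exp.mpr ?_
        have h2 : (1 : ℝ) / (4 * c) ≤ 1 / 4 := by
          rw [div_le_div_iff₀ (by positivity) (by norm_num)]; linarith
        calc |y ^ 2 - 1| / (4 * c) ≤ (y ^ 2 + 1) / (4 * c) := by gcongr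
          _ = y ^ 2 / (4 * c) + 1 / (4 * c) := by ring
          _ ≤ _ := by linarith
    _ = Real.exp (1 / 4) * Real.exp (y ^ 2 / (4 * c)) := Real.exp_add _ _
    _ ≤ _ := by gcongr; exact exp_quarter_le

theorem integrable_exp_sq_sub_one {Y : S → ℝ} {c : ℝ≥0} (hc : 1 ≤ c)
    (h : HasSubgaussianMGF Y c μ) {l : ℝ} (hl : |l| ≤ 1 / (8 * c)) :
    Integrable (fun s => Real.exp (l * (Y s ^ 2 - 1))) μ := by
  have hc' : (1 : ℝ) ≤ c := hc
  have hm := h.aemeasurable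
  refine ((integrable_exp_sq (zero_lt_one.trans_le hc) h).const_mul 2).mono' (by fun_prop)
    (ae_of_all _ fun s => ?_)
  rw [Real.norm_of_nonneg (Real.exp_pos _).le]
  refine le_trans (Real.exp_le_exp.mpr ?_) (exp_abs_sq_sub_one_le hc' (Y s))
  refine (le_abs_self _).trans ?_
  rw [abs_mul]
  calc _ ≤ 1 / (8 * (c : ℝ)) * |Y s ^ 2 - 1| := by gcongr
    _ ≤ 1 / (4 * (c : ℝ)) * |Y s ^ 2 - 1| := by gcongr; norm_num
    _ = _ := by ring

/-- Second-order expansion of the exponential: the linear term has mean zero as `E Y² = 1`. Since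
`|l| ≤ 1 / (8c)`, only half of the available exponent `|w| / (4c)` is used by `exp |l w|`; the other
half absorbs `w²`. -/
theorem mgf_sq_sub_one_le {Y : S → ℝ} {c : ℝ≥0} (hc : 1 ≤ c) (h : HasSubgaussianMGF Y c μ)
    (hvar : ∫ s, Y s ^ 2 ∂μ = 1) {l : ℝ} (hl : |l| ≤ 1 / (8 * c)) :
    mgf (fun s => Y s ^ 2 - 1) μ l ≤ Real.exp (512 * c ^ 2 * l ^ 2) := by
  have hc' : (1 : ℝ) ≤ c := hc
  have hc0 : (0 : ℝ) < c := by linarith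
  have hpt : ∀ y : ℝ, Real.exp (l * (y ^ 2 - 1)) ≤
      1 + l * (y ^ 2 - 1) + l ^ 2 * (256 * c ^ 2 * Real.exp (y ^ 2 / (4 * c))) := by
    intro y
    set w := y ^ 2 - 1 with hw
    have h1 := exp_le_one_add_add (l * w)
    have h2 : Real.exp |l * w| ≤ Real.exp (|w| / (8 * c)) := by
      refine Real.exp_le_exp.mpr ?_
      rw [abs_mul]
      calc _ ≤ 1 / (8 * c) * |w| := by gcongr
        _ = _ := by ring
    have h3 : w ^ 2 ≤ 128 * c ^ 2 * Real.exp (|w| / (8 * c)) := by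
      have h4 := Real.quadratic_le_exp_of_nonneg (x := |w| / (8 * c)) (by positivity)
      have h5 : (|w| / (8 * c)) ^ 2 / 2 ≤ Real.exp (|w| / (8 * c)) := by
        have : 0 ≤ |w| / (8 * c) := by positivity
        linarith
      have h6 : w ^ 2 = 128 * c ^ 2 * ((|w| / (8 * c)) ^ 2 / 2) := by
        rw [div_pow, sq_abs]; field_simp; ring
      rw [h6]
      gcongr
    have h7 : w ^ 2 * Real.exp |l * w| ≤ 256 * c ^ 2 * Real.exp (y ^ 2 / (4 * c)) := by
      calc w ^ 2 * Real.exp |l * w|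
          ≤ 128 * c ^ 2 * Real.exp (|w| / (8 * c)) * Real.exp (|w| / (8 * c)) := by gcongr
        _ = 128 * c ^ 2 * Real.exp (|w| / (4 * c)) := by
            rw [mul_assoc, ← Real.exp_add]; congr 2; field_simp; ring
        _ ≤ 128 * c ^ 2 * (2 * Real.exp (y ^ 2 / (4 * c))) := by
            gcongr; exact exp_abs_sq_sub_one_le hc' y
        _ = _ := by ring
    refine h1.trans ?_
    rw [mul_pow, mul_assoc (l ^ 2)]
    gcongr
  have hsq : Integrable (fun s => Y s ^ 2) μ := (h.memLp 2).integrable_sq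
  have hsq1 : Integrable (fun s => l * (Y s ^ 2 - 1)) μ :=
    (hsq.sub (integrable_const 1)).const_mul l
  have hexp := integrable_exp_sq (zero_lt_one.trans_le hc) h
  have hexp' : Integrable
      (fun s => l ^ 2 * (256 * c ^ 2 * Real.exp (Y s ^ 2 / (4 * c)))) μ :=
    (hexp.const_mul _).const_mul _
  have h1 : Integrable (fun s => 1 + l * (Y s ^ 2 - 1)) μ := (integrable_const 1).add hsq1
  calc mgf (fun s => Y s ^ 2 - 1) μ l
      ≤ ∫ s, (1 + l * (Y s ^ 2 - 1)
          + l ^ 2 * (256 * c ^ 2 * Real.exp (Y s ^ 2 / (4 * c)))) ∂μ :=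
        integral_mono (integrable_exp_sq_sub_one hc h hl) (h1.add hexp') fun s => hpt (Y s)
    _ = 1 + l ^ 2 * (256 * c ^ 2 * ∫ s, Real.exp (Y s ^ 2 / (4 * c)) ∂μ) := by
        rw [integral_add h1 hexp', integral_add (integrable_const 1) hsq1, integral_const_mul,
          integral_sub hsq (integrable_const 1), hvar, integral_const_mul, integral_const_mul]
        simp
    _ ≤ 1 + l ^ 2 * (256 * c ^ 2 * 2) := by
        gcongr; exact integral_exp_sq_le (zero_lt_one.trans_le hc) h
    _ ≤ Real.exp (512 * c ^ 2 * l ^ 2) := by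
        have := Real.add_one_le_exp (512 * c ^ 2 * l ^ 2)
        linarith

/-- The Bernstein inequality for squares of independent sub-Gaussian variables. -/
theorem measureReal_abs_sum_sq_sub_one_le {m : ℕ} {Y : Fin m → S → ℝ} {c : ℝ≥0} (hc : 1 ≤ c)
    (hY : iIndepFun Y μ) (h : ∀ i, HasSubgaussianMGF (Y i) c μ)
    (hvar : ∀ i, ∫ s, Y i s ^ 2 ∂μ = 1) {t : ℝ} (ht : 0 ≤ t) (ht1 : t ≤ 1) :
    μ.real {s | m * t ≤ |∑ i, (Y i s ^ 2 - 1)|}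
      ≤ 2 * Real.exp (-(m * t ^ 2 / (2048 * c ^ 2))) := by
  have hc' : (1 : ℝ) ≤ c := hc
  have hc0 : (0 : ℝ) < c := by linarith
  -- measurable versions
  let Z : Fin m → S → ℝ := fun i => (h i).aemeasurable.mk (Y i)
  have hYZ : ∀ i, Y i =ᵐ[μ] Z i := fun i => (h i).aemeasurable.ae_eq_mk
  have hZm : ∀ i, Measurable (Z i) := fun i => (h i).aemeasurable.measurable_mk
  have hZ : iIndepFun Z μ := hY.congr hYZ
  have hZs : ∀ i, HasSubgaussianMGF (Z i) c μ := fun i => (h i).congr (hYZ i)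
  have hZvar : ∀ i, ∫ s, Z i s ^ 2 ∂μ = 1 := fun i => by
    rw [← hvar i]
    exact integral_congr_ae ((hYZ i).mono fun s hs => by simp [hs])
  let W : Fin m → S → ℝ := fun i s => Z i s ^ 2 - 1
  have hW : iIndepFun W μ := hZ.comp (fun _ x => x ^ 2 - 1) (fun _ => by fun_prop)
  have hWm : ∀ i, Measurable (W i) := fun i => ((hZm i).pow_const 2).sub_const 1
  set X : S → ℝ := ∑ i, W i with hX
  have hint : ∀ l : ℝ, |l| ≤ 1 / (8 * c) → Integrable (fun s => Real.exp (l * X s)) μ :=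
    fun l hl => hW.integrable_exp_mul_sum hWm
      fun i _ => integrable_exp_sq_sub_one hc (hZs i) hl
  have hmgf : ∀ l : ℝ, |l| ≤ 1 / (8 * c) → mgf X μ l ≤ Real.exp (m * (512 * c ^ 2 * l ^ 2)) := by
    intro l hl
    rw [hX, hW.mgf_sum hWm, Real.exp_nat_mul]
    calc _ ≤ ∏ i : Fin m, Real.exp (512 * c ^ 2 * l ^ 2) :=
          Finset.prod_le_prod (fun i _ => mgf_nonneg)
            fun i _ => mgf_sq_sub_one_le hc (hZs i) (hZvar i) hl
      _ = _ := by simp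
  -- The minimizer of `-l m t + 512 m c² l²`; `t ≤ 1 ≤ c` keeps it in the admissible range.
  set l := t / (1024 * (c : ℝ) ^ 2) with hl
  have hl0 : 0 ≤ l := by positivity
  have hle : |l| ≤ 1 / (8 * c) := by
    rw [abs_of_nonneg hl0, hl, div_le_div_iff₀ (by positivity) (by positivity)]
    nlinarith
  have hexp : Real.exp (-l * (m * t)) * Real.exp (m * (512 * c ^ 2 * l ^ 2))
      = Real.exp (-(m * t ^ 2 / (2048 * c ^ 2))) := by
    rw [← Real.exp_add, hl]
    congr 1
    field_simp
    ring
  have h1 : μ.real {s | m * t ≤ X s} ≤ Real.exp (-(m * t ^ 2 / (2048 * c ^ 2))) := by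
    refine (measure_ge_le_exp_mul_mgf (m * t) hl0 (hint l hle)).trans ?_
    rw [← hexp]
    gcongr
    exact hmgf l hle
  have h2 : μ.real {s | X s ≤ -(m * t)} ≤ Real.exp (-(m * t ^ 2 / (2048 * c ^ 2))) := by
    have hle' : |-l| ≤ 1 / (8 * c) := by rwa [abs_neg]
    refine (measure_le_le_exp_mul_mgf (-(m * t)) (neg_nonpos.mpr hl0) (hint (-l) hle')).trans ?_
    rw [← hexp, neg_neg, mul_neg, ← neg_mul]
    gcongr
    simpa using hmgf (-l) hle'
  have hae : ({s | m * t ≤ |∑ i, (Y i s ^ 2 - 1)|} : Set S)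
      =ᵐ[μ] ({s | m * t ≤ |X s|} : Set S) := by
    filter_upwards [ae_all_iff.mpr hYZ] with s hs
    have : ∑ i, (Y i s ^ 2 - 1) = X s := by
      rw [hX, Finset.sum_apply]
      exact Finset.sum_congr rfl fun i _ => by rw [hs i]
    change (m * t ≤ |∑ i, (Y i s ^ 2 - 1)|) = (m * t ≤ |X s|)
    rw [this]
  rw [measureReal_congr hae]
  have hsub : ({s | m * t ≤ |X s|} : Set S) ⊆ {s | m * t ≤ X s} ∪ {s | X s ≤ -(m * t)} := by
    intro s hs
    rcases le_abs.mp (show m * t ≤ |X s| from hs) with h | h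
    · exact Or.inl h
    · right; change X s ≤ -(m * t); linarith
  refine (measureReal_mono hsub).trans ((measureReal_union_le _ _).trans ?_)
  linarith

/-- Independent entries make independent rows. -/
theorem iIndepFun_curry {ι κ : Type*} [Fintype ι] [Fintype κ] {X : ι → κ → S → ℝ}
    (hm : ∀ i j, AEMeasurable (X i j) μ) (h : iIndepFun (fun (q : ι × κ) s => X q.1 q.2 s) μ) :
    iIndepFun (fun i s j => X i j s) μ := by
  have hm' : ∀ i, AEMeasurable (fun s j => X i j s) μ := fun i => aemeasurable_pi_iff.mpr (hm i)
  have : ∀ i j, IsProbabilityMeasure (μ.map (X i j)) :=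
    fun i j => Measure.isProbabilityMeasure_map (hm i j)
  rw [iIndepFun_iff_map_fun_eq_pi_map hm']
  have hrow : ∀ i, μ.map (fun s j => X i j s) = Measure.infinitePi fun j => μ.map (X i j) := by
    intro i
    rw [Measure.infinitePi_eq_pi]
    exact iIndepFun.map_fun_eq_pi_map (hm i) (h.precomp (g := fun j => (i, j))
      fun a b hab => by simpa using hab)
  simp_rw [hrow]
  have h1 := iIndepFun.map_fun_eq_pi_map (fun q : ι × κ => hm q.1 q.2) h
  rw [← Measure.infinitePi_eq_pi] at h1
  have h2 := Measure.infinitePi_map_curry fun i j => μ.map (X i j)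
  rw [← h1, AEMeasurable.map_map_of_aemeasurable (by fun_prop)
    (aemeasurable_pi_iff.mpr fun q : ι × κ => hm q.1 q.2), Measure.infinitePi_eq_pi] at h2
  exact h2

/-- The variables `√m (M v)ᵢ` are independent, with variance `‖v‖² = 1` and variance proxy `K`. The
proxy is enlarged to `K + 1` because the Bernstein inequality asks for at least `1`. -/
theorem IsSubgaussianMatrix.measureReal_le {m d : ℕ} {K : ℝ≥0} {M : S → Matrix (Fin m) (Fin d) ℝ}
    (hM : IsSubgaussianMatrix μ K M) {v : Fin d → ℝ} (hv : l2 v = 1) {t : ℝ} (ht : 0 ≤ t)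
    (ht1 : t ≤ 1) :
    μ.real {s | t ≤ |l2 (M s *ᵥ v) ^ 2 - 1|}
      ≤ 2 * Real.exp (-(m * t ^ 2 / (2048 * (K + 1) ^ 2))) := by
  rcases Nat.eq_zero_or_pos m with rfl | hm
  · simp only [Nat.cast_zero, zero_mul, zero_div, neg_zero, Real.exp_zero, mul_one]
    exact measureReal_le_one.trans one_le_two
  have hm0 : (0 : ℝ) < m := by exact_mod_cast hm
  have hsm : √(m : ℝ) ^ 2 = m := Real.sq_sqrt hm0.le
  have hrow : ∀ i, iIndepFun (fun j s => √m * M s i j) μ := fun i =>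
    (hM.indep.precomp (g := fun j => (i, j)) fun a b hab => by simpa using hab).comp
      (fun _ x => √m * x) (fun _ => by fun_prop)
  let Y : Fin m → S → ℝ := fun i s => ∑ j, v j * (√m * M s i j)
  have hYs : ∀ i, HasSubgaussianMGF (Y i) (K + 1) μ := fun i =>
    hasSubgaussianMGF_sum_mul (hrow i) (fun j => hM.subgaussian i j) v (by
      rw [hv]; push_cast; linarith)
  have hYi : iIndepFun Y μ :=
    (iIndepFun_curry (X := fun i j s => M s i j) hM.aemeasurable hM.indep).comp
      (fun _ x => ∑ j, v j * (√m * x j)) (fun _ => by fun_prop)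
  have hvar : ∀ i, ∫ s, Y i s ^ 2 ∂μ = 1 := by
    intro i
    have hL : ∀ j, MemLp (fun s => v j * (√m * M s i j)) 2 μ := fun j =>
      ((hM.subgaussian i j).memLp 2).const_mul (v j)
    have h1 := IndepFun.variance_sum (s := Finset.univ) (μ := μ)
      (X := fun j s => v j * (√m * M s i j)) (fun j _ => hL j)
      (fun a _ b _ hab => ((hrow i).comp (fun j x => v j * x) (fun _ => by fun_prop)).indepFun hab)
    have hmean : ∀ j, ∫ s, v j * (√m * M s i j) ∂μ = 0 := fun j => by
      rw [integral_const_mul, integral_const_mul, hM.mean]; simp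
    have hYsum : (∑ j, fun s => v j * (√m * M s i j)) = Y i := by
      ext s; simp [Y]
    have hYmean : ∫ s, Y i s ∂μ = 0 := by
      rw [integral_finsetSum _ fun j _ => (hL j).integrable (by norm_num)]
      exact Finset.sum_eq_zero fun j _ => hmean j
    have hvj : ∀ j, Var[fun s => v j * (√m * M s i j); μ] = v j ^ 2 := fun j => by
      rw [variance_of_integral_eq_zero (hL j).aestronglyMeasurable.aemeasurable (hmean j)]
      simp only [mul_pow]
      rw [integral_const_mul, integral_const_mul, hM.variance, hsm]
      field_simp
    rw [hYsum, variance_of_integral_eq_zero (hYs i).aemeasurable hYmean] at h1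
    rw [h1]
    simp_rw [hvj]
    rw [← l2_sq_eq_sum, hv, one_pow]
  have key := measureReal_abs_sum_sq_sub_one_le (c := K + 1) (by simp) hYi hYs hvar ht ht1
  push_cast at key
  refine le_trans (le_of_eq ?_) key
  congr 1
  ext s
  have : ∑ i, (Y i s ^ 2 - 1) = m * (l2 (M s *ᵥ v) ^ 2 - 1) := by
    rw [Finset.sum_sub_distrib, l2_sq_eq_sum, mul_sub, Finset.mul_sum]
    congr 1
    · refine Finset.sum_congr rfl fun i _ => ?_
      have : Y i s = √m * (M s *ᵥ v) i := by
        simp only [Y, Matrix.mulVec, dotProduct, Finset.mul_sum]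
        exact Finset.sum_congr rfl fun j _ => by ring
      rw [this, mul_pow, hsm]
    · simp
  change t ≤ _ ↔ m * t ≤ _
  rw [this, abs_mul, abs_of_pos hm0]
  exact (mul_le_mul_iff_right₀ hm0).symm

end Bernstein

/-! ### Nets in the unit ball -/

section Net

open Module

variable {E : Type*} [NormedAddCommGroup E] [NormedSpace ℝ E] [FiniteDimensional ℝ E]

/-- A `1/2`-separated subset of the unit ball has at most `5 ^ dim` points, by the volume bound for
`1`-separated sets in the ball of radius `2`. If no such set were a net, separated sets could be
enlarged forever. -/
theorem exists_half_net : ∃ N : Finset E, N.card ≤ 5 ^ finrank ℝ E ∧ (∀ n ∈ N, ‖n‖ ≤ 1) ∧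
    ∀ v : E, ‖v‖ ≤ 1 → ∃ n ∈ N, ‖v - n‖ ≤ 1 / 2 := by
  classical
  have hcard : ∀ s : Finset E, (∀ n ∈ s, ‖n‖ ≤ 1) →
      (∀ a ∈ s, ∀ b ∈ s, a ≠ b → 1 / 2 ≤ ‖a - b‖) → s.card ≤ 5 ^ finrank ℝ E := by
    intro s hs hsep
    have hinj : Function.Injective fun v : E => (2 : ℝ) • v :=
      smul_right_injective E (two_ne_zero (α := ℝ))
    rw [← Finset.card_image_of_injective s hinj]
    refine Besicovitch.card_le_of_separated _ ?_ ?_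
    · intro c hc
      obtain ⟨a, ha, rfl⟩ := Finset.mem_image.mp hc
      rw [norm_smul, Real.norm_ofNat]
      linarith [hs a ha]
    · intro c hc c' hc' hne
      obtain ⟨a, ha, rfl⟩ := Finset.mem_image.mp hc
      obtain ⟨b, hb, rfl⟩ := Finset.mem_image.mp hc'
      rw [← smul_sub, norm_smul, Real.norm_ofNat]
      have := hsep a ha b hb fun h => hne (by rw [h])
      linarith
  by_contra! hcon
  have hbuild : ∀ n : ℕ, ∃ s : Finset E, s.card = n ∧ (∀ n ∈ s, ‖n‖ ≤ 1) ∧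
      (∀ a ∈ s, ∀ b ∈ s, a ≠ b → 1 / 2 ≤ ‖a - b‖) := by
    intro n
    induction n with
    | zero => exact ⟨∅, by simp⟩
    | succ n ih =>
      obtain ⟨s, hn, hs, hsep⟩ := ih
      obtain ⟨v, hv, hfar⟩ := hcon s (hcard s hs hsep) hs
      have hvs : v ∉ s := fun h => by
        have := hfar v h
        simp at this
        linarith
      refine ⟨insert v s, by rw [Finset.card_insert_of_notMem hvs, hn], ?_, ?_⟩
      · intro a ha
        rcases Finset.mem_insert.mp ha with rfl | ha
        exacts [hv, hs a ha]
      · intro a ha b hb hne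
        rcases Finset.mem_insert.mp ha with ha' | ha' <;>
          rcases Finset.mem_insert.mp hb with hb' | hb'
        · exact absurd (ha'.trans hb'.symm) hne
        · rw [ha']; exact (hfar b hb').le
        · rw [hb', norm_sub_rev]; exact (hfar a ha').le
        · exact hsep a ha' b hb' hne
  obtain ⟨s, hn, hs, hsep⟩ := hbuild (5 ^ finrank ℝ E + 1)
  have := hcard s hs hsep
  omega

/-- Two scales: approximate `v` by `a`, then `2 (v - a)` by `b`, and use `a + b / 2`. -/
theorem exists_quarter_net : ∃ N : Finset E, N.card ≤ 25 ^ finrank ℝ E ∧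
    ∀ v : E, ‖v‖ ≤ 1 → ∃ n ∈ N, ‖v - n‖ ≤ 1 / 4 := by
  classical
  obtain ⟨N, hN, -, hnet⟩ := exists_half_net (E := E)
  refine ⟨Finset.image₂ (fun a b => a + (1 / 2 : ℝ) • b) N N, ?_, fun v hv => ?_⟩
  · refine (Finset.card_image₂_le _ _ _).trans ((Nat.mul_le_mul hN hN).trans ?_)
    rw [← mul_pow]; norm_num
  · obtain ⟨a, ha, hva⟩ := hnet v hv
    obtain ⟨b, hb, hvb⟩ := hnet ((2 : ℝ) • (v - a)) (by
      rw [norm_smul, Real.norm_ofNat]; linarith)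
    refine ⟨_, Finset.mem_image₂_of_mem ha hb, ?_⟩
    have e : v - (a + (1 / 2 : ℝ) • b) = (1 / 2 : ℝ) • ((2 : ℝ) • (v - a) - b) := by
      module
    rw [e, norm_smul, Real.norm_of_nonneg (by norm_num)]
    linarith

end Net

/-! ### The D-RIP of sub-Gaussian matrices -/

section RIP

open Module

/-- A matrix that is nearly isometric on a suitable finite set is nearly isometric on the whole
subspace. -/
theorem exists_net_near_isometry {d : ℕ} (V : Submodule ℝ (EuclideanSpace ℝ (Fin d))) :
    ∃ N : Finset (Fin d → ℝ), N.card ≤ 25 ^ finrank ℝ V ∧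
      ∀ (m : ℕ) (M : Matrix (Fin m) (Fin d) ℝ) (t : ℝ), 0 ≤ t →
        (∀ n ∈ N, |l2 (M *ᵥ n) ^ 2 - l2 n ^ 2| ≤ t * l2 n ^ 2) →
        ∀ v, WithLp.toLp 2 v ∈ V → |l2 (M *ᵥ v) ^ 2 - l2 v ^ 2| ≤ 6 * t * l2 v ^ 2 := by
  classical
  obtain ⟨N, hN, hnet⟩ := exists_quarter_net (E := V)
  refine ⟨N.image fun n : V => (n : EuclideanSpace ℝ (Fin d)).ofLp,
    Finset.card_image_le.trans hN, fun m M t ht hgood v hv => ?_⟩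
  let f : V → Fin d → ℝ := fun x => (x : EuclideanSpace ℝ (Fin d)).ofLp
  let q : V → ℝ := fun x => |l2 (M *ᵥ f x) ^ 2 - l2 (f x) ^ 2|
  have hfc : Continuous f := (PiLp.continuous_ofLp 2 _).comp continuous_subtype_val
  have hl2 : ∀ n : ℕ, Continuous (l2 : (Fin n → ℝ) → ℝ) := fun n =>
    continuous_norm.comp (PiLp.continuous_toLp 2 _)
  have hq : Continuous q := by
    refine continuous_abs.comp (Continuous.sub ?_ ?_)
    · exact ((hl2 m).comp (Continuous.matrix_mulVec continuous_const hfc)).pow 2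
    · exact ((hl2 d).comp hfc).pow 2
  have hqsmul : ∀ (a : ℝ) (x : V), q (a • x) = a ^ 2 * q x := by
    intro a x
    have : f (a • x) = a • f x := rfl
    simp only [q, this, Matrix.mulVec_smul, l2_smul, mul_pow, sq_abs]
    rw [← mul_sub, abs_mul, abs_of_nonneg (sq_nonneg a)]
  -- The defect is compared at a maximizer `v₀` and at a nearby net point `n`. This yields `β ≤ q n
  -- + (9/16) β` with `q n ≤ (25/16) t`, hence `β ≤ (25/7) t`. The net does not depend on `M`, as
  -- the union bound requires.
  obtain ⟨v₀, hv₀, hmax⟩ := (isCompact_closedBall (0 : V) 1).exists_isMaxOn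
    ⟨0, Metric.mem_closedBall_self zero_le_one⟩ hq.continuousOn
  set β := q v₀ with hβ
  have hv₀' : ‖v₀‖ ≤ 1 := by simpa using hv₀
  have hβ0 : 0 ≤ β := abs_nonneg _
  have hall : ∀ x : V, q x ≤ β * ‖x‖ ^ 2 := by
    intro x
    rcases eq_or_ne x 0 with rfl | hx
    · have := hqsmul 0 0
      simp at this
      simp [this]
    · have hx0 : 0 < ‖x‖ := norm_pos_iff.mpr hx
      have h1 : q (‖x‖⁻¹ • x) ≤ β := hmax (by
        rw [mem_closedBall_zero_iff, norm_smul, norm_inv, norm_norm, inv_mul_cancel₀ hx0.ne'])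
      rw [hqsmul] at h1
      have h2 : q x = ‖x‖ ^ 2 * (‖x‖⁻¹ ^ 2 * q x) := by field_simp
      rw [h2, mul_comm β]
      gcongr
  obtain ⟨n, hnN, hn⟩ := hnet v₀ hv₀'
  have hnnorm : ‖n‖ ≤ 5 / 4 := by
    have : n = v₀ - (v₀ - n) := by abel
    rw [this]
    refine (norm_sub_le _ _).trans ?_
    linarith
  have hqn : q n ≤ t * (5 / 4) ^ 2 := by
    refine (hgood _ (Finset.mem_image_of_mem _ hnN)).trans ?_
    have : l2 (f n) ≤ 5 / 4 := hnnorm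
    have := l2_nonneg (f n)
    change t * l2 (f n) ^ 2 ≤ _
    gcongr
  -- A difference of squares factors through `v₀ - n` and `v₀ + n`, and the first factor is short.
  have hpol := abs_dotProduct_sub_le M (a := f (v₀ - n)) (b := f (v₀ + n)) (δ := β)
    fun r s => hall (r • (v₀ - n) + s • (v₀ + n))
  have hdiff : β ≤ q n + β * (1 / 4 * (9 / 4)) := by
    have h1 : (l2 (M *ᵥ f v₀) ^ 2 - l2 (f v₀) ^ 2) - (l2 (M *ᵥ f n) ^ 2 - l2 (f n) ^ 2)
        = -(f (v₀ - n) ⬝ᵥ f (v₀ + n) - (M *ᵥ f (v₀ - n)) ⬝ᵥ (M *ᵥ f (v₀ + n))) := by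
      have e1 : f (v₀ - n) = f v₀ - f n := rfl
      have e2 : f (v₀ + n) = f v₀ + f n := rfl
      simp only [e1, e2, l2_sq, Matrix.mulVec_add, Matrix.mulVec_sub, dotProduct_add,
        sub_dotProduct, dotProduct_comm (f n) (f v₀),
        dotProduct_comm (M *ᵥ f n) (M *ᵥ f v₀)]
      ring
    have h2 : β - q n ≤ |(l2 (M *ᵥ f v₀) ^ 2 - l2 (f v₀) ^ 2)
        - (l2 (M *ᵥ f n) ^ 2 - l2 (f n) ^ 2)| := abs_sub_abs_le_abs_sub _ _
    rw [h1, abs_neg] at h2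
    have h3 : l2 (f (v₀ - n)) ≤ 1 / 4 := hn
    have h4 : l2 (f (v₀ + n)) ≤ 9 / 4 := by
      refine (norm_add_le v₀ n).trans ?_
      linarith
    have h5 : β * (l2 (f (v₀ - n)) * l2 (f (v₀ + n))) ≤ β * (1 / 4 * (9 / 4)) := by
      have := l2_nonneg (f (v₀ + n))
      gcongr
    linarith
  have hβt : β ≤ 6 * t := by linarith
  have := hall ⟨WithLp.toLp 2 v, hv⟩
  refine this.trans ?_
  change β * l2 v ^ 2 ≤ _
  gcongr

theorem choose_le_exp_mul_div_pow {p k : ℕ} (hk : 1 ≤ k) :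
    ((2 * p).choose (4 * k) : ℝ) ≤ (Real.exp 1 * p / k) ^ (4 * k) := by
  have hk0 : (0 : ℝ) < k := by exact_mod_cast hk
  have h1 := Nat.choose_le_pow_div (α := ℝ) (4 * k) (2 * p)
  have h2 := Real.pow_div_factorial_le_exp (x := 4 * k) (by positivity) (4 * k)
  have hf : (0 : ℝ) < (4 * k).factorial := by positivity
  have e1 : Real.exp (4 * k) = Real.exp 1 ^ (4 * k) := by
    rw [← Real.exp_nat_mul]; push_cast; rw [mul_one]
  rw [e1] at h2
  calc ((2 * p).choose (4 * k) : ℝ) ≤ ((2 * p : ℕ) : ℝ) ^ (4 * k) / (4 * k).factorial := h1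
    _ = (p / (2 * k)) ^ (4 * k) * ((4 * k) ^ (4 * k) / (4 * k).factorial) := by
        rw [← mul_div_assoc, ← mul_pow]
        congr 2
        push_cast
        field_simp
        ring
    _ ≤ (p / (2 * k)) ^ (4 * k) * Real.exp 1 ^ (4 * k) := by gcongr
    _ = (Real.exp 1 * p / k * (1 / 2)) ^ (4 * k) := by
        rw [← mul_pow]; congr 1; field_simp
    _ ≤ (Real.exp 1 * p / k) ^ (4 * k) := by
        gcongr
        have : 0 ≤ Real.exp 1 * p / k := by positivity
        linarith

theorem one_le_log_exp_mul_div {p k : ℕ} (hk : 1 ≤ k) (hkp : k ≤ p) :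
    1 ≤ Real.log (Real.exp 1 * p / k) := by
  have hk0 : (0 : ℝ) < k := by exact_mod_cast hk
  have hkp' : (k : ℝ) ≤ p := by exact_mod_cast hkp
  have hp0 : (0 : ℝ) < p := hk0.trans_le hkp'
  rw [Real.le_log_iff_exp_le (by positivity), le_div_iff₀ hk0]
  gcongr

/-- The constant of proportionality in the number of measurements for the D-RIP. -/
noncomputable def ripConst (K : ℝ≥0) : ℝ := 40 * (73728 * (K + 1) ^ 2)

theorem ripConst_pos (K : ℝ≥0) : 0 < ripConst K := by unfold ripConst; positivity

variable {S : Type*} [MeasurableSpace S] {μ : Measure S} [IsProbabilityMeasure μ]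

/-- Sub-Gaussian matrices have the D-RIP for any given dictionary with `2p` atoms. -/
theorem IsSubgaussianMatrix.measureReal_not_hasDRIP_le {ι : Type*} [Fintype ι] {m p d k : ℕ}
    {K : ℝ≥0} {M : S → Matrix (Fin m) (Fin d) ℝ} (hM : IsSubgaussianMatrix μ K M)
    (D : Matrix (Fin d) ι ℝ) (hι : Fintype.card ι = 2 * p) (hk : 1 ≤ k) (hkp : k ≤ p)
    {δ : ℝ} (hδ : 0 ≤ δ) (hδ1 : δ ≤ 1)
    (hm : ripConst K * (k * Real.log (Real.exp 1 * p / k)) ≤ m * δ ^ 2) :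
    μ.real {s | ¬ HasDRIP (M s) D (4 * k) δ} ≤ 2 * Real.exp (-(m * δ ^ 2 / ripConst K)) := by
  classical
  let V : Finset ι → Submodule ℝ (EuclideanSpace ℝ (Fin d)) := fun F =>
    Submodule.span ℝ (F.image fun i => WithLp.toLp 2 (D.col i) : Finset _)
  have hV : ∀ F, finrank ℝ (V F) ≤ F.card := fun F =>
    (finrank_span_finset_le_card _).trans Finset.card_image_le
  choose N hNcard hN using fun F => exists_net_near_isometry (V F)
  -- Supports are padded to exactly `j` atoms, so that a binomial coefficient counts them; `4k` may
  -- exceed the number `2p` of atoms.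
  set j := min (4 * k) (2 * p) with hj
  set 𝓕 := Finset.powersetCard j (Finset.univ : Finset ι) with h𝓕
  set t := δ / 6 with ht
  have ht0 : 0 ≤ t := by positivity
  set b := 2 * Real.exp (-(m * t ^ 2 / (2048 * (K + 1) ^ 2))) with hb
  -- The strict inequality makes the event empty for the net point `n = 0`.
  have hsub : {s | ¬ HasDRIP (M s) D (4 * k) δ} ⊆ ⋃ F ∈ 𝓕, ⋃ n ∈ N F,
      {s | t * l2 n ^ 2 < |l2 (M s *ᵥ n) ^ 2 - l2 n ^ 2|} := by
    intro s hs
    by_contra hcon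
    refine hs fun α hα => ?_
    simp only [Set.mem_iUnion, not_exists] at hcon
    have hsupp : (Finset.univ.filter fun i => α i ≠ 0).card ≤ j := by
      refine le_min ?_ ?_
      · rw [IsSparse] at hα
        refine le_trans (le_of_eq ?_) hα
        rw [← Set.ncard_coe_finset]
        congr 1
        ext i; simp
      · exact (Finset.card_le_univ _).trans hι.le
    obtain ⟨F, hFsub, hF⟩ := Finset.exists_superset_card_eq hsupp
      (by rw [hι]; exact min_le_right _ _)
    have hmem : WithLp.toLp 2 (D *ᵥ α) ∈ V F := by
      have e : WithLp.toLp 2 (D *ᵥ α) = ∑ i, α i • WithLp.toLp 2 (D.col i) := by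
        ext x
        simp [Matrix.mulVec, dotProduct, mul_comm]
      rw [e]
      refine Submodule.sum_mem _ fun i _ => ?_
      by_cases hi : α i = 0
      · simp [hi]
      · refine Submodule.smul_mem _ _ (Submodule.subset_span ?_)
        exact Finset.mem_coe.mpr (Finset.mem_image_of_mem _ (hFsub (by simp [hi])))
    have h1 := hN F m (M s) t ht0 (fun n hn => not_lt.mp
      (hcon F (Finset.mem_powersetCard.mpr ⟨Finset.subset_univ _, hF⟩) n hn)) _ hmem
    have e6 : 6 * t = δ := by rw [ht]; ring
    rw [e6, abs_le] at h1
    constructor <;> linarith [h1.1, h1.2]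
  have hpt : ∀ n : Fin d → ℝ,
      μ.real {s | t * l2 n ^ 2 < |l2 (M s *ᵥ n) ^ 2 - l2 n ^ 2|} ≤ b := by
    intro n
    rcases eq_or_ne (l2 n) 0 with h0 | h0
    · have : {s | t * l2 n ^ 2 < |l2 (M s *ᵥ n) ^ 2 - l2 n ^ 2|} = ∅ := by
        ext s
        simp [eq_zero_of_l2_eq_zero h0]
      rw [this, measureReal_empty]
      positivity
    · have hpos : 0 < l2 n := lt_of_le_of_ne (l2_nonneg n) (Ne.symm h0)
      have h1 : l2 ((l2 n)⁻¹ • n) = 1 := by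
        rw [l2_smul, abs_of_pos (by positivity), inv_mul_cancel₀ h0]
      refine le_trans (measureReal_mono fun s hs => ?_)
        (hM.measureReal_le h1 ht0 (by rw [ht]; linarith))
      have hs' : t * l2 n ^ 2 < |l2 (M s *ᵥ n) ^ 2 - l2 n ^ 2| := hs
      change t ≤ |l2 (M s *ᵥ ((l2 n)⁻¹ • n)) ^ 2 - 1|
      rw [Matrix.mulVec_smul, l2_smul, abs_of_pos (inv_pos.mpr hpos), mul_pow]
      have e : (l2 n)⁻¹ ^ 2 * l2 (M s *ᵥ n) ^ 2 - 1
          = (l2 (M s *ᵥ n) ^ 2 - l2 n ^ 2) / l2 n ^ 2 := by field_simp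
      rw [e, abs_div, abs_of_pos (pow_pos hpos 2), le_div_iff₀ (by positivity)]
      exact hs'.le
  set L := Real.log (Real.exp 1 * p / k) with hL
  have hL1 : 1 ≤ L := one_le_log_exp_mul_div hk hkp
  have hk0 : (0 : ℝ) < k := by exact_mod_cast hk
  have hp0 : (0 : ℝ) < p := hk0.trans_le (by exact_mod_cast hkp)
  have hexpL : Real.exp (4 * k * L) = (Real.exp 1 * p / k) ^ (4 * k) := by
    rw [← Real.exp_log (show 0 < Real.exp 1 * p / k by positivity), ← Real.exp_nat_mul]
    push_cast
    rfl
  have h𝓕card : (𝓕.card : ℝ) ≤ Real.exp (4 * k * L) := by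
    rw [h𝓕, Finset.card_powersetCard, Finset.card_univ, hι]
    rcases le_total (4 * k) (2 * p) with h | h
    · rw [hj, min_eq_left h, hexpL]
      exact choose_le_exp_mul_div_pow hk
    · rw [hj, min_eq_right h, Nat.choose_self, Nat.cast_one]
      exact Real.one_le_exp (by positivity)
  have hNF : ∀ F ∈ 𝓕, ((N F).card : ℝ) ≤ Real.exp (16 * k * L) := by
    intro F hF
    have h1 : (N F).card ≤ 25 ^ (4 * k) := by
      refine (hNcard F).trans (Nat.pow_le_pow_right (by norm_num) ((hV F).trans ?_))
      rw [(Finset.mem_powersetCard.mp hF).2]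
      exact min_le_left _ _
    have h25 : (25 : ℝ) ≤ Real.exp 4 := by
      have h2 := Real.exp_one_gt_d9
      have : Real.exp 4 = Real.exp 1 ^ 4 := by rw [← Real.exp_nat_mul]; norm_num
      rw [this]
      calc (25 : ℝ) ≤ 2.7 ^ 4 := by norm_num
        _ ≤ _ := by gcongr; linarith
    calc ((N F).card : ℝ) ≤ (25 : ℝ) ^ (4 * k) := by exact_mod_cast h1
      _ ≤ Real.exp 4 ^ (4 * k) := by gcongr
      _ = Real.exp (16 * k) := by rw [← Real.exp_nat_mul]; push_cast; ring_nf
      _ ≤ _ := by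
        refine Real.exp_le_exp.mpr ?_
        nlinarith
  calc μ.real {s | ¬ HasDRIP (M s) D (4 * k) δ}
      ≤ μ.real (⋃ F ∈ 𝓕, ⋃ n ∈ N F, {s | t * l2 n ^ 2 < |l2 (M s *ᵥ n) ^ 2 - l2 n ^ 2|}) :=
        measureReal_mono hsub (measure_ne_top _ _)
    _ ≤ ∑ F ∈ 𝓕, ∑ n ∈ N F, μ.real {s | t * l2 n ^ 2 < |l2 (M s *ᵥ n) ^ 2 - l2 n ^ 2|} :=
        (measureReal_biUnion_finset_le _ _).trans
          (Finset.sum_le_sum fun F _ => measureReal_biUnion_finset_le _ _)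
    _ ≤ ∑ F ∈ 𝓕, Real.exp (16 * k * L) * b := by
        refine Finset.sum_le_sum fun F hF => (Finset.sum_le_sum fun n _ => hpt n).trans ?_
        rw [Finset.sum_const, nsmul_eq_mul]
        exact mul_le_mul_of_nonneg_right (hNF F hF) (by positivity)
    _ ≤ Real.exp (4 * k * L) * (Real.exp (16 * k * L) * b) := by
        rw [Finset.sum_const, nsmul_eq_mul]
        exact mul_le_mul_of_nonneg_right h𝓕card (by positivity)
    _ = 2 * Real.exp (20 * (k * L) - m * t ^ 2 / (2048 * (K + 1) ^ 2)) := by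
        rw [hb, sub_eq_add_neg, Real.exp_add, show 20 * (k * L) = 4 * k * L + 16 * k * L by ring,
          Real.exp_add]
        ring
    _ ≤ _ := by
        gcongr
        -- `73728 = 2048 · 36` accounts for `t = δ / 6`. The union bound costs `exp (20 k L)`: `4kL`
        -- for the supports and `16kL` for the nets, since `25 ≤ exp 4`. The factor `40` in
        -- `ripConst` makes this at most half of the decay.
        have hK : (0 : ℝ) < 73728 * (K + 1) ^ 2 := by positivity
        have e1 : m * t ^ 2 / (2048 * (K + 1) ^ 2) = m * δ ^ 2 / (73728 * ((K : ℝ) + 1) ^ 2) := by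
          rw [ht]; field_simp; ring
        rw [e1]
        unfold ripConst at hm ⊢
        set a := 73728 * ((K : ℝ) + 1) ^ 2
        have h1 : 20 * (k * L) ≤ m * δ ^ 2 / a / 2 := by
          rw [le_div_iff₀ two_pos, le_div_iff₀ hK]
          linarith
        have h2 : m * δ ^ 2 / (40 * a) = m * δ ^ 2 / a / 40 := by
          rw [div_div, mul_comm a]
        have h3 : 0 ≤ m * δ ^ 2 / a := by positivity
        rw [h2]
        linarith

end RIP

/-! ### Matrices adapted to the spectrum of `Ωᵀ Ω` -/

section Existence

theorem isSubgaussianMatrix_gaussian {m : ℕ} (hm : 0 < m) (d : ℕ) :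
    IsSubgaussianMatrix (Measure.pi fun _ : Fin m × Fin d => gaussianReal 0 (1 / m)) 1
      (fun s => Matrix.of fun i j => s (i, j)) where
  aemeasurable i j := (measurable_pi_apply (i, j)).aemeasurable
  indep := iIndepFun_pi (X := fun _ x => x) fun _ => aemeasurable_id
  mean i j := by
    have h := integral_id_gaussianReal (μ := 0) (v := 1 / m)
    have h2 := (measurePreserving_eval (fun _ : Fin m × Fin d => gaussianReal 0 (1 / m))
      (i, j)).map_eq
    rw [← h2, integral_map (measurable_pi_apply _).aemeasurable (by fun_prop)] at h
    exact h
  variance i j := by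
    have h := variance_of_integral_eq_zero (μ := gaussianReal 0 (1 / m)) (X := fun x => x)
      aemeasurable_id integral_id_gaussianReal
    have h2 := (measurePreserving_eval (fun _ : Fin m × Fin d => gaussianReal 0 (1 / m))
      (i, j)).map_eq
    rw [variance_fun_id_gaussianReal, ← h2, integral_map (measurable_pi_apply _).aemeasurable
      (by fun_prop)] at h
    push_cast at h
    exact h.symm
  subgaussian i j := by
    have hm0 : (0 : ℝ) < m := by exact_mod_cast hm
    have h1 : HasSubgaussianMGF (fun s : Fin m × Fin d → ℝ => s (i, j)) (1 / m)
        (Measure.pi fun _ => gaussianReal 0 (1 / m)) :=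
      HasSubgaussianMGF.of_map (X := id) (measurable_pi_apply (i, j)).aemeasurable (by
        rw [(measurePreserving_eval _ (i, j)).map_eq]
        exact hasSubgaussianMGF_id_gaussianReal _)
    refine hasSubgaussianMGF_mono (h1.const_mul √m) (le_of_eq ?_)
    rw [← NNReal.coe_inj]
    push_cast
    change √(m : ℝ) ^ 2 * (1 / m) = 1
    rw [Real.sq_sqrt hm0.le]
    field_simp

/-- Probabilistic method with a Gaussian matrix: the failure probability is at most `2 / e < 1`. -/
theorem exists_hasDRIP {ι : Type*} [Fintype ι] {m p d k : ℕ} (D : Matrix (Fin d) ι ℝ)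
    (hι : Fintype.card ι = 2 * p) (hk : 1 ≤ k) (hkp : k ≤ p) {δ : ℝ} (hδ : 0 ≤ δ) (hδ1 : δ ≤ 1)
    (hm : ripConst 1 * (k * Real.log (Real.exp 1 * p / k)) ≤ m * δ ^ 2) :
    ∃ G : Matrix (Fin m) (Fin d) ℝ, HasDRIP G D (4 * k) δ := by
  have hL := one_le_log_exp_mul_div hk hkp
  have hk1 : (1 : ℝ) ≤ k := by exact_mod_cast hk
  have hc := ripConst_pos 1
  have hle : ripConst 1 ≤ m * δ ^ 2 := by
    refine le_trans ?_ hm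
    exact le_mul_of_one_le_right hc.le (one_le_mul_of_one_le_of_one_le hk1 hL)
  have hm0 : 0 < m := by
    rcases Nat.eq_zero_or_pos m with rfl | h
    · simp at hle; linarith
    · exact h
  by_contra! hcon
  have h1 := (isSubgaussianMatrix_gaussian hm0 d).measureReal_not_hasDRIP_le D hι hk hkp hδ hδ1 hm
  have huniv : {s : Fin m × Fin d → ℝ |
      ¬ HasDRIP (Matrix.of fun i j => s (i, j)) D (4 * k) δ} = Set.univ :=
    Set.eq_univ_of_forall fun s => hcon _
  rw [huniv, probReal_univ] at h1
  have h2 : Real.exp (-(m * δ ^ 2 / ripConst 1)) ≤ Real.exp (-1) := by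
    refine Real.exp_le_exp.mpr (neg_le_neg ?_)
    rwa [le_div_iff₀ hc, one_mul]
  have h3 := Real.exp_neg_one_lt_d9
  linarith

theorem dotProduct_conj_diagonal {d : ℕ} (U : Matrix (Fin d) (Fin d) ℝ) (f : Fin d → ℝ)
    (x : Fin d → ℝ) :
    x ⬝ᵥ ((U * Matrix.diagonal f * Uᵀ) *ᵥ x) = ∑ i, f i * (Uᵀ *ᵥ x) i ^ 2 := by
  rw [← Matrix.mulVec_mulVec, ← Matrix.mulVec_mulVec, Matrix.dotProduct_mulVec,
    ← Matrix.mulVec_transpose, dotProduct]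
  refine Finset.sum_congr rfl fun i _ => ?_
  rw [Matrix.mulVec_diagonal]
  ring

/-- The spectral projection of `Ωᵀ Ω` for the eigenvalues below `θ`. -/
theorem exists_spectral_projection {p d : ℕ} (Ω : Matrix (Fin p) (Fin d) ℝ) (θ : ℝ) :
    ∃ P : Matrix (Fin d) (Fin d) ℝ, Pᵀ = P ∧ P * P = P ∧ P * (Ωᵀ * Ω) = (Ωᵀ * Ω) * P ∧
      (∀ x, l2 (Ω *ᵥ (P *ᵥ x)) ^ 2 ≤ θ * l2 (P *ᵥ x) ^ 2) ∧
      ∀ x, θ * l2 ((1 - P) *ᵥ x) ^ 2 ≤ l2 (Ω *ᵥ ((1 - P) *ᵥ x)) ^ 2 := by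
  have hH : (Ωᵀ * Ω).IsHermitian := by
    simpa using Matrix.isHermitian_conjTranspose_mul_self Ω
  set U : Matrix (Fin d) (Fin d) ℝ := (hH.eigenvectorUnitary).1 with hU
  set ev := hH.eigenvalues with hev
  have hU1 : Uᵀ * U = 1 := by
    have := Unitary.coe_star_mul_self hH.eigenvectorUnitary
    rwa [Matrix.star_eq_conjTranspose, Matrix.conjTranspose_eq_transpose_of_trivial] at this
  have hU2 : U * Uᵀ = 1 := mul_eq_one_comm.mp hU1
  have hspec : Ωᵀ * Ω = U * Matrix.diagonal ev * Uᵀ := by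
    have := hH.spectral_theorem
    rw [Unitary.conjStarAlgAut_apply, Matrix.star_eq_conjTranspose,
      Matrix.conjTranspose_eq_transpose_of_trivial] at this
    exact this
  have hmul : ∀ f g : Fin d → ℝ, (U * Matrix.diagonal f * Uᵀ) * (U * Matrix.diagonal g * Uᵀ)
      = U * Matrix.diagonal (fun i => f i * g i) * Uᵀ := by
    intro f g
    calc _ = U * Matrix.diagonal f * (Uᵀ * U) * Matrix.diagonal g * Uᵀ := by
          simp only [Matrix.mul_assoc]
      _ = _ := by rw [hU1, Matrix.mul_one, Matrix.mul_assoc U, Matrix.diagonal_mul_diagonal]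
  have htr : ∀ f : Fin d → ℝ, (U * Matrix.diagonal f * Uᵀ)ᵀ = U * Matrix.diagonal f * Uᵀ := by
    intro f
    simp [Matrix.transpose_mul, Matrix.mul_assoc]
  have hnorm : ∀ (X Y : Matrix (Fin d) (Fin d) ℝ) (x : Fin d → ℝ), Yᵀ = Y →
      (Y *ᵥ x) ⬝ᵥ (X *ᵥ (Y *ᵥ x)) = x ⬝ᵥ ((Y * X * Y) *ᵥ x) := by
    intro X Y x hY
    rw [← Matrix.mulVec_mulVec, ← Matrix.mulVec_mulVec, Matrix.dotProduct_mulVec _ Y,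
      ← Matrix.mulVec_transpose, hY]
  have hΩ : ∀ y : Fin d → ℝ, l2 (Ω *ᵥ y) ^ 2 = y ⬝ᵥ ((Ωᵀ * Ω) *ᵥ y) := by
    intro y
    rw [l2_sq, ← Matrix.mulVec_mulVec, Matrix.dotProduct_mulVec y, Matrix.vecMul_transpose]
  have hq : ∀ (f : Fin d → ℝ) (x : Fin d → ℝ),
      l2 (Ω *ᵥ ((U * Matrix.diagonal f * Uᵀ) *ᵥ x)) ^ 2
        = ∑ i, f i * ev i * f i * (Uᵀ *ᵥ x) i ^ 2 := by
    intro f x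
    rw [hΩ, hnorm _ _ _ (htr f), hspec, hmul, hmul, dotProduct_conj_diagonal]
  have hn : ∀ (f : Fin d → ℝ) (x : Fin d → ℝ),
      l2 ((U * Matrix.diagonal f * Uᵀ) *ᵥ x) ^ 2 = ∑ i, f i * f i * (Uᵀ *ᵥ x) i ^ 2 := by
    intro f x
    have := hnorm 1 _ x (htr f)
    rw [Matrix.one_mulVec, Matrix.mul_one, hmul, dotProduct_conj_diagonal] at this
    rw [l2_sq, this]
  let χ : Fin d → ℝ := fun i => if ev i ≤ θ then 1 else 0
  have hcompl : 1 - U * Matrix.diagonal χ * Uᵀ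
      = U * Matrix.diagonal (fun i => 1 - χ i) * Uᵀ := by
    have e : Matrix.diagonal (fun i => 1 - χ i) = 1 - Matrix.diagonal χ := by
      rw [← Matrix.diagonal_one, Matrix.diagonal_sub]
    rw [e, Matrix.mul_sub, Matrix.sub_mul, Matrix.mul_one, hU2]
  refine ⟨U * Matrix.diagonal χ * Uᵀ, htr χ, ?_, ?_, fun x => ?_, fun x => ?_⟩
  · rw [hmul]
    congr 3
    ext i
    simp only [χ]
    split_ifs <;> norm_num
  · rw [hspec, hmul, hmul]
    simp_rw [mul_comm]
  · rw [hq, hn, Finset.mul_sum]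
    refine Finset.sum_le_sum fun i _ => ?_
    have := sq_nonneg ((Uᵀ *ᵥ x) i)
    by_cases h : ev i ≤ θ
    · simp only [χ, h, if_true]
      nlinarith
    · simp [χ, h]
  · rw [hcompl, hq, hn, Finset.mul_sum]
    refine Finset.sum_le_sum fun i _ => ?_
    have := sq_nonneg ((Uᵀ *ᵥ x) i)
    by_cases h : ev i ≤ θ
    · simp [χ, h]
    · simp only [χ, h, if_false, sub_zero, one_mul, mul_one]
      push Not at h
      nlinarith

variable {m p d k : ℕ} {A B : ℝ} {Ω : Matrix (Fin p) (Fin d) ℝ}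

theorem l2_projection_le {P : Matrix (Fin d) (Fin d) ℝ} (hP : Pᵀ = P) (hPP : P * P = P)
    (x : Fin d → ℝ) : l2 (P *ᵥ x) ≤ l2 x := by
  refine l2_le_of_sq_le_mul (l2_nonneg x) ?_
  have : l2 (P *ᵥ x) ^ 2 = x ⬝ᵥ (P *ᵥ x) := by
    have h : (P *ᵥ x) ⬝ᵥ (P *ᵥ x) = x ⬝ᵥ ((P * P) *ᵥ x) := by
      rw [← Matrix.mulVec_mulVec, Matrix.dotProduct_mulVec x P, ← Matrix.mulVec_transpose, hP]
    rw [l2_sq, h, hPP]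
  rw [this]
  exact (le_abs_self _).trans (abs_dotProduct_le _ _)

theorem dotProduct_projection {P : Matrix (Fin d) (Fin d) ℝ} (hP : Pᵀ = P) (hPP : P * P = P)
    (x y : Fin d → ℝ) : (P *ᵥ x) ⬝ᵥ (P *ᵥ y) = (P *ᵥ x) ⬝ᵥ y := by
  rw [Matrix.dotProduct_mulVec, ← Matrix.mulVec_transpose, hP, Matrix.mulVec_mulVec, hPP]

/-- `P Ωᵀ` is the transpose of `Ω P`, so both have the same norm. This is the gain on the low part
of the spectrum. -/
theorem l2_projection_transpose_le {P : Matrix (Fin d) (Fin d) ℝ} (hP : Pᵀ = P) (hPP : P * P = P)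
    {r : ℝ} (hr : 0 ≤ r) (h : ∀ x, l2 (Ω *ᵥ (P *ᵥ x)) ^ 2 ≤ r ^ 2 * l2 (P *ᵥ x) ^ 2)
    (u : Fin p → ℝ) : l2 (P *ᵥ (Ωᵀ *ᵥ u)) ≤ r * l2 u := by
  refine l2_le_of_sq_le_mul (mul_nonneg hr (l2_nonneg u)) ?_
  set y := P *ᵥ (Ωᵀ *ᵥ u) with hy
  have h1 : l2 y ^ 2 = (Ω *ᵥ y) ⬝ᵥ u := by
    rw [l2_sq]
    conv_lhs => rw [hy, dotProduct_projection hP hPP, ← hy]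
    rw [Matrix.dotProduct_mulVec, Matrix.vecMul_transpose]
  have h2 : l2 (Ω *ᵥ y) ≤ r * l2 y := by
    have := h (Ωᵀ *ᵥ u)
    rw [← mul_pow] at this
    exact (sq_le_sq₀ (l2_nonneg _) (mul_nonneg hr (l2_nonneg _))).mp this
  rw [h1]
  refine (le_abs_self _).trans ((abs_dotProduct_le _ _).trans ?_)
  have := mul_le_mul_of_nonneg_right h2 (l2_nonneg u)
  linarith

theorem transpose_mul_mul_pinv (hinj : Function.Injective Ω.mulVec) :
    Ωᵀ * Ω * pinv Ω = Ωᵀ := by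
  have h := pinv_penrose hinj
  rw [Matrix.mul_assoc, ← h.2.2.2.1, ← Matrix.transpose_mul, h.2.1]

/-- Because `Q` commutes with `Ωᵀ Ω`, the map `Ω Q Ω†` is a contraction, while `Ω` expands the range
of `Q` by at least `r`. This is the gain on the high part of the spectrum. -/
theorem l2_projection_pinv_le {Q : Matrix (Fin d) (Fin d) ℝ} (hQ : Qᵀ = Q) (hQQ : Q * Q = Q)
    (hcomm : Q * (Ωᵀ * Ω) = (Ωᵀ * Ω) * Q) (hinj : Function.Injective Ω.mulVec) {r : ℝ}
    (hr : 0 < r) (h : ∀ x, r ^ 2 * l2 (Q *ᵥ x) ^ 2 ≤ l2 (Ω *ᵥ (Q *ᵥ x)) ^ 2) (v : Fin p → ℝ) :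
    l2 (Q *ᵥ (pinv Ω *ᵥ v)) ≤ 1 / r * l2 v := by
  set z := Q *ᵥ (pinv Ω *ᵥ v) with hz
  have h1 : l2 (Ω *ᵥ z) ≤ l2 v := by
    refine l2_le_of_sq_le_mul (l2_nonneg v) ?_
    have e : (Ωᵀ * Ω) *ᵥ z = Q *ᵥ (Ωᵀ *ᵥ v) := by
      rw [hz, Matrix.mulVec_mulVec, ← hcomm, ← Matrix.mulVec_mulVec, Matrix.mulVec_mulVec v,
        transpose_mul_mul_pinv hinj]
    have e2 : l2 (Ω *ᵥ z) ^ 2 = (Ω *ᵥ z) ⬝ᵥ v := by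
      have e3 : l2 (Ω *ᵥ z) ^ 2 = z ⬝ᵥ ((Ωᵀ * Ω) *ᵥ z) := by
        rw [l2_sq, ← Matrix.mulVec_mulVec, Matrix.dotProduct_mulVec z, Matrix.vecMul_transpose]
      rw [e3, e]
      conv_lhs => rw [hz, dotProduct_projection hQ hQQ, ← hz]
      rw [Matrix.dotProduct_mulVec, Matrix.vecMul_transpose]
    rw [e2]
    refine (le_abs_self _).trans ((abs_dotProduct_le _ _).trans (le_of_eq (mul_comm _ _)))
  have h2 : r * l2 z ≤ l2 (Ω *ᵥ z) := by
    have := h (pinv Ω *ᵥ v)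
    rw [← mul_pow] at this
    exact (sq_le_sq₀ (mul_nonneg hr.le (l2_nonneg _)) (l2_nonneg _)).mp this
  rw [one_div, ← div_eq_inv_mul, le_div_iff₀ hr]
  linarith

theorem exists_stacked {m₁ m₂ : ℕ} (X : Matrix (Fin m₁) (Fin d) ℝ)
    (Y : Matrix (Fin m₂) (Fin d) ℝ) : ∃ M : Matrix (Fin (m₁ + m₂)) (Fin d) ℝ, ∀ a b : Fin d → ℝ,
      (M *ᵥ a) ⬝ᵥ (M *ᵥ b) = (X *ᵥ a) ⬝ᵥ (X *ᵥ b) + (Y *ᵥ a) ⬝ᵥ (Y *ᵥ b) := by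
  refine ⟨(Matrix.fromRows X Y).submatrix finSumFinEquiv.symm id, fun a b => ?_⟩
  have e : ∀ a : Fin d → ℝ, (Matrix.fromRows X Y).submatrix finSumFinEquiv.symm id *ᵥ a
      = (Matrix.fromRows X Y *ᵥ a) ∘ finSumFinEquiv.symm := fun a => rfl
  rw [e, e, comp_equiv_dotProduct_comp_equiv, Matrix.fromRows_mulVec, Matrix.fromRows_mulVec]
  simp [dotProduct]

/-- A matrix with `m = O((B / A) k log (p / k))` rows that is adapted to the frame: its upper and
lower halves act on the spectral subspaces of `Ωᵀ Ω` below and above `A B`. -/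
theorem exists_restrictedContraction (hΩ : IsFrame Ω A B) (hd : 0 < d) (hk : 1 ≤ k) (hkp : k ≤ p)
    (hm : (128 * ripConst 1 + 1) * (B / A) * (k * Real.log (Real.exp 1 * p / k)) ≤ m) :
    ∃ M : Matrix (Fin m) (Fin d) ℝ, RestrictedContraction k B Ω M := by
  have hA := hΩ.pos
  have hAB := hΩ.le hd
  have hB : 0 < B := hA.trans_le hAB
  have hL := one_le_log_exp_mul_div hk hkp
  have hk1 : (1 : ℝ) ≤ k := by exact_mod_cast hk
  set L := (k : ℝ) * Real.log (Real.exp 1 * p / k) with hLdef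
  have hL1 : 1 ≤ L := one_le_mul_of_one_le_of_one_le hk1 hL
  have hBA : 1 ≤ B / A := (one_le_div hA).mpr hAB
  set r := √(A * B) with hr
  have hr2 : r ^ 2 = A * B := Real.sq_sqrt (by positivity)
  have hr0 : 0 < r := Real.sqrt_pos.mpr (by positivity)
  have hrB : r ≤ B := by
    rw [hr, Real.sqrt_le_left hB.le]; nlinarith
  -- Equal to `√(A / B) / 8`, so that both `δ · r / A` and `δ · B / r` are `1/8`; the two halves
  -- together give `1/4`.
  set δ := r / (8 * B) with hδ
  have hδ0 : 0 ≤ δ := by positivity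
  have hδ1 : δ ≤ 1 := by rw [hδ, div_le_one (by positivity)]; linarith
  have hδ2 : δ ^ 2 = A / (64 * B) := by rw [hδ, div_pow, hr2]; field_simp; norm_num
  have hrows : ∀ n : ℕ, (m : ℝ) ≤ 2 * n + 1 → ripConst 1 * L ≤ n * δ ^ 2 := by
    intro n hn
    -- `64` is from `δ ^ 2 = A / (64B)`. It doubles to `128` as each half gets about `m / 2` rows,
    -- and the extra `1` in the hypothesis pays for rounding.
    have h1 : 64 * ripConst 1 * (B / A) * L ≤ n := by
      have : 1 ≤ B / A * L := one_le_mul_of_one_le_of_one_le hBA hL1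
      nlinarith
    rw [hδ2, ← mul_div_assoc, le_div_iff₀ (by positivity)]
    calc ripConst 1 * L * (64 * B) = 64 * ripConst 1 * (B / A) * L * A := by field_simp
      _ ≤ n * A := by gcongr
  obtain ⟨m₁, m₂, rfl, hm₁, hm₂⟩ : ∃ m₁ m₂ : ℕ, m = m₁ + m₂ ∧ m ≤ 2 * m₁ + 1 ∧ m ≤ 2 * m₂ + 1 :=
    ⟨m / 2, m - m / 2, by omega, by omega, by omega⟩
  obtain ⟨P, hP, hPP, hPH, hlow, hhigh⟩ := exists_spectral_projection Ω (r ^ 2)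
  set Q := 1 - P with hQ
  have hQt : Qᵀ = Q := by rw [hQ, Matrix.transpose_sub, Matrix.transpose_one, hP]
  have hQQ : Q * Q = Q := by
    rw [hQ, Matrix.mul_sub, Matrix.sub_mul, Matrix.sub_mul, hPP]; simp
  have hQH : Q * (Ωᵀ * Ω) = (Ωᵀ * Ω) * Q := by
    rw [hQ, Matrix.sub_mul, Matrix.mul_sub, hPH, Matrix.one_mul, Matrix.mul_one]
  have hsplit : ∀ x y : Fin d → ℝ,
      x ⬝ᵥ y = (P *ᵥ x) ⬝ᵥ (P *ᵥ y) + (Q *ᵥ x) ⬝ᵥ (Q *ᵥ y) := by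
    intro x y
    rw [dotProduct_projection hP hPP, dotProduct_projection hQt hQQ, ← add_dotProduct,
      ← Matrix.add_mulVec, hQ, add_sub_cancel, Matrix.one_mulVec]
  have hcard : Fintype.card (Fin p ⊕ Fin p) = 2 * p := by simp; ring
  obtain ⟨G₁, hG₁⟩ := exists_hasDRIP (m := m₁) (Matrix.fromCols (P * pinv Ω) (P * Ωᵀ)) hcard hk hkp
    hδ0 hδ1 (hrows m₁ (by exact_mod_cast hm₁))
  obtain ⟨G₂, hG₂⟩ := exists_hasDRIP (m := m₂) (Matrix.fromCols (Q * pinv Ω) (Q * Ωᵀ)) hcard hk hkp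
    hδ0 hδ1 (hrows m₂ (by exact_mod_cast hm₂))
  obtain ⟨M, hM⟩ := exists_stacked (G₁ * P) (G₂ * Q)
  simp only [← Matrix.mulVec_mulVec] at hM
  refine ⟨M, fun u v hu hv => ?_, fun u hu => ?_⟩
  · have h1 := hG₁.abs_dotProduct_sub_le hu hv
    have h2 := hG₂.abs_dotProduct_sub_le hu hv
    simp only [← Matrix.mulVec_mulVec] at h1 h2
    have hu0 := l2_nonneg u
    have hv0 := l2_nonneg v
    have b1 : l2 (P *ᵥ (Ωᵀ *ᵥ u)) * l2 (P *ᵥ (pinv Ω *ᵥ v)) ≤ (r * l2 u) * (1 / A * l2 v) :=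
      mul_le_mul (l2_projection_transpose_le hP hPP hr0.le hlow u)
        ((l2_projection_le hP hPP _).trans (hΩ.l2_pinv_mulVec_le v)) (l2_nonneg _) (by positivity)
    have b2 : l2 (Q *ᵥ (Ωᵀ *ᵥ u)) * l2 (Q *ᵥ (pinv Ω *ᵥ v)) ≤ (B * l2 u) * (1 / r * l2 v) :=
      mul_le_mul ((l2_projection_le hQt hQQ _).trans (hΩ.l2_transpose_mulVec_le u))
        (l2_projection_pinv_le hQt hQQ hQH hΩ.injective hr0 hhigh v) (l2_nonneg _) (by positivity)
    -- `P` and `Q` have orthogonal ranges and `M` is stacked, so neither form has cross terms and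
    -- the defect splits into one for each half.
    rw [hM, hsplit (Ωᵀ *ᵥ u)]
    rw [add_sub_add_comm]
    have e1 : δ * (r * l2 u * (1 / A * l2 v)) = 1 / 8 * (l2 u * l2 v) := by
      calc _ = r ^ 2 / (8 * B * A) * (l2 u * l2 v) := by rw [hδ]; ring
        _ = _ := by rw [hr2]; field_simp
    have e2 : δ * (B * l2 u * (1 / r * l2 v)) = 1 / 8 * (l2 u * l2 v) := by
      rw [hδ]; field_simp
    refine (abs_add_le _ _).trans ((add_le_add h1 h2).trans ?_)
    have c1 := mul_le_mul_of_nonneg_left b1 hδ0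
    have c2 := mul_le_mul_of_nonneg_left b2 hδ0
    linarith
  · have h1 := hG₁.l2_sq_le hu
    have h2 := hG₂.l2_sq_le hu
    simp only [← Matrix.mulVec_mulVec] at h1 h2
    have hu0 := l2_nonneg u
    have h3 := hΩ.l2_transpose_mulVec_le u
    have h0 := l2_nonneg (Ωᵀ *ᵥ u)
    have hs := hsplit (Ωᵀ *ᵥ u) (Ωᵀ *ᵥ u)
    have hMu := hM (Ωᵀ *ᵥ u) (Ωᵀ *ᵥ u)
    simp only [← l2_sq] at hs hMu
    refine (sq_le_sq₀ (l2_nonneg _) (by positivity)).mp ?_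
    calc l2 (M *ᵥ (Ωᵀ *ᵥ u)) ^ 2 ≤ (1 + δ) * l2 (Ωᵀ *ᵥ u) ^ 2 := by
          rw [hMu, hs]; linarith
      _ ≤ (1 + 1) * (B * l2 u) ^ 2 := by gcongr
      _ ≤ (2 * B * l2 u) ^ 2 := by nlinarith [sq_nonneg (B * l2 u)]

end Existence

/-- Sub-Gaussian matrices have both recovery guarantees with overwhelming probability. -/
theorem IsSubgaussianMatrix.measure_not_guarantee_le {m p d k : ℕ} {A B : ℝ}
    {Ω : Matrix (Fin p) (Fin d) ℝ} (hΩ : IsFrame Ω A B) (hk : 1 ≤ k) (hkp : k ≤ p)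
    {S : Type*} [MeasurableSpace S] {μ : Measure S} [IsProbabilityMeasure μ] {K : ℝ≥0}
    {M : S → Matrix (Fin m) (Fin d) ℝ} (hM : IsSubgaussianMatrix μ K M)
    (hm : 16 * ripConst K * (B / A) ^ 2 * (k * Real.log (Real.exp 1 * p / k)) ≤ m)
    {C : ℝ} (hC : 9000 ≤ C) :
    μ {s | ¬ Guarantee C k A B Ω (M s)} ≤
      ENNReal.ofReal (2 * Real.exp (-(m * (A / B) ^ 2 / (16 * ripConst K)))) := by
  have hA := hΩ.pos
  rcases Nat.eq_zero_or_pos d with rfl | hd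
  · have : {s | ¬ Guarantee C k A B Ω (M s)} = ∅ :=
      Set.eq_empty_of_forall_notMem fun s hs => hs
        ((RestrictedContraction.of_dim_zero Ω (M s) hΩ.nonneg).guarantee hk hΩ hC)
    rw [this, measure_empty]
    exact zero_le
  have hAB := hΩ.le hd
  have hB : 0 < B := hA.trans_le hAB
  have hc := ripConst_pos K
  have hδ : (A / (4 * B)) ^ 2 = (A / B) ^ 2 / 16 := by field_simp; norm_num
  have h := hM.measureReal_not_hasDRIP_le (Matrix.fromCols (pinv Ω) Ωᵀ)
    (by simp; ring) hk hkp (δ := A / (4 * B)) (by positivity)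
    (by rw [div_le_one (by positivity)]; linarith) (by
      rw [hδ]
      set L := (k : ℝ) * Real.log (Real.exp 1 * p / k)
      calc ripConst K * L = (16 * ripConst K * (B / A) ^ 2 * L) * ((A / B) ^ 2 / 16) := by
            field_simp
        _ ≤ _ := by gcongr)
  have e : m * (A / (4 * B)) ^ 2 / ripConst K = m * (A / B) ^ 2 / (16 * ripConst K) := by
    rw [hδ]; field_simp
  rw [e] at h
  have hsub : {s | ¬ Guarantee C k A B Ω (M s)} ⊆
      {s | ¬ HasDRIP (M s) (Matrix.fromCols (pinv Ω) Ωᵀ) (4 * k) (A / (4 * B))} :=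
    fun s hs hD => hs ((HasDRIP.restrictedContraction hΩ hD).guarantee hk hΩ hC)
  exact (measure_mono hsub).trans
    ((ENNReal.le_ofReal_iff_toReal_le (measure_ne_top _ _) (by positivity)).mpr h)

end TDIHT

theorem theorem1 :
    ∃ C : ℝ, 0 < C ∧
      (∀ (k p d : ℕ) (Ω : Matrix (Fin p) (Fin d) ℝ) (A B : ℝ),
        1 ≤ k → k ≤ p → TDIHT.IsFrame Ω A B →
        -- some matrix with `m = O((B / A) k log (p / k))` rows has both recovery guarantees
        (∀ m : ℕ, C * (B / A) * (k * Real.log (Real.exp 1 * p / k)) ≤ m →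
          ∃ M : Matrix (Fin m) (Fin d) ℝ, TDIHT.Guarantee C k A B Ω M) ∧
        -- so does every matrix with the D-RIP for the dictionary `[Ω†, Ωᵀ]`
        (∀ (m : ℕ) (M : Matrix (Fin m) (Fin d) ℝ),
          TDIHT.HasDRIP M (Matrix.fromCols (TDIHT.pinv Ω) Ωᵀ) (4 * k) (A / (4 * B)) →
          TDIHT.Guarantee C k A B Ω M)) ∧
      -- and a sub-Gaussian matrix, with overwhelming probability
      (∀ K : ℝ≥0, ∃ c : ℝ, 0 < c ∧
        ∀ (k p d : ℕ) (Ω : Matrix (Fin p) (Fin d) ℝ) (A B : ℝ),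
        1 ≤ k → k ≤ p → TDIHT.IsFrame Ω A B →
        ∀ m : ℕ, c * (B / A) ^ 2 * (k * Real.log (Real.exp 1 * p / k)) ≤ m →
        ∀ (S : Type*) [MeasurableSpace S] (μ : Measure S) [IsProbabilityMeasure μ]
          (M : S → Matrix (Fin m) (Fin d) ℝ), TDIHT.IsSubgaussianMatrix μ K M →
          μ {s | ¬ TDIHT.Guarantee C k A B Ω (M s)} ≤
            ENNReal.ofReal (2 * Real.exp (-(m * (A / B) ^ 2 / c)))) := by
  have hc := TDIHT.ripConst_pos 1
  -- A single constant serves both the row count, which needs `128 * ripConst 1 + 1`, and the error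
  -- bounds, which need `9000`.
  refine ⟨128 * TDIHT.ripConst 1 + 9000, by positivity, ?_, ?_⟩
  · intro k p d Ω A B hk hkp hΩ
    refine ⟨fun m hm => ?_, fun m M hM =>
      (hM.restrictedContraction hΩ).guarantee hk hΩ (by linarith)⟩
    obtain ⟨M, hM⟩ : ∃ M : Matrix (Fin m) (Fin d) ℝ, TDIHT.RestrictedContraction k B Ω M := by
      rcases Nat.eq_zero_or_pos d with rfl | hd
      · exact ⟨0, .of_dim_zero Ω 0 hΩ.nonneg⟩
      · refine TDIHT.exists_restrictedContraction hΩ hd hk hkp (le_trans ?_ hm)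
        have hA := hΩ.pos
        have hB := hΩ.nonneg
        have hL := TDIHT.one_le_log_exp_mul_div hk hkp
        gcongr
        norm_num
    exact ⟨M, hM.guarantee hk hΩ (by linarith)⟩
  · intro K
    have hK := TDIHT.ripConst_pos K
    refine ⟨16 * TDIHT.ripConst K, by positivity, ?_⟩
    intro k p d Ω A B hk hkp hΩ m hm S _ μ _ M hM
    exact hM.measure_not_guarantee_le hΩ hk hkp hm (by linarith)
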